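/- All graphs are finite and simple. A set $D\subseteq V(G)$ is dominating if every vertex of $G$ is in $D$ or adjacent to a vertex of $D$, and $\gamma(G)$ is the minimum cardinality of a dominating set. Let $G$ be a $3$-$\gamma$-vertex-critical graph, i.e. $\gamma(G)=3$ and $\gamma(G-v)<\gamma(G)$ for every vertex $v\in V(G)$. A graph is $K_{1,r}$-free if it has no induced subgraph isomorphic to $K_{1,r}$; a near perfect matching is a matching that covers all vertices but exactly one. **Theorem.** 1. If $G$ is $K_{1,6}$-free and $|V(G)|$ is even with $|V(G)|\neq 12$, then $G$ has a perfect matching. 2. If $G$ is $K_{1,7}$-free, $|V(G)|$ is odd with $|V(G)|\neq 13$, and exactly one connected component of $G$ has an odd number of vertices, then either $G$ has a near perfect matching or $G$ is isomorphic to one of the following three graphs: - the graph on the nine vertices $s_i$ $(1\le i\le 3)$ and $c_{j,e}$ $(1\le j\le 3,\ e\in\{1,2\})$ whose edges are exactly the pairs $s_ic_{j,e}$ with $i\ne j$; - one of the two graphs on the fifteen vertices $a_1,a_2,a_3,b_1,b_2,b_3$ and $x_{i,j}$ $(1\le i,j\le 3)$ such that the $x_{i,j}$ are pairwise non-adjacent,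 each $x_{i,j}$ is adjacent to exactly the four vertices of $\{a_1,a_2,a_3,b_1,b_2,b_3\}\setminus\{a_i,b_j\}$, and the subgraph induced on $\{a_1,a_2,a_3,b_1,b_2,b_3\}$ is either the complete bipartite graph $K_{3,3}$ with parts $\{a_1,a_2,a_3\}$ and $\{b_1,b_2,b_3\}$, or the triangular prism with triangles $a_1a_2a_3$ and $b_1b_2b_3$ and further edges $a_1b_1,a_2b_2,a_3b_3$. -/

import Mathlib

namespace DomCrit

/-- `D` is a dominating set of `G`: every vertex lies in `D` or has a neighbour in `D`. -/
def IsDominatingSet {V : Type*} (G : SimpleGraph V) (D : Finset V) : Prop :=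
  ∀ v : V, v ∈ D ∨ ∃ u ∈ D, G.Adj u v

/-- The domination number: the least cardinality of a dominating set. (For a finite
graph the whole vertex set is dominating, so the infimum is attained.) -/
noncomputable def dominationNumber {V : Type*} (G : SimpleGraph V) : ℕ :=
  sInf {n : ℕ | ∃ D : Finset V, IsDominatingSet G D ∧ D.card = n}

/-- `G` is `k`-γ-vertex-critical: `γ(G) = k`, and `γ(G - v) < γ(G)` for every vertex `v`. -/
def IsGammaVertexCritical {V : Type*} (k : ℕ) (G : SimpleGraph V) : Prop :=
  dominationNumber G = k ∧
    ∀ v : V, dominationNumber (G.induce {v}ᶜ) < dominationNumber G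

/-- `G` is `K_{1,r}`-free: it has no induced subgraph isomorphic to the star `K_{1,r}`. -/
def IsStarFree {V : Type*} (r : ℕ) (G : SimpleGraph V) : Prop :=
  ¬ (completeBipartiteGraph (Fin 1) (Fin r)).IsIndContained G

/-- `G` has a perfect matching. -/
def HasPerfectMatching {V : Type*} (G : SimpleGraph V) : Prop :=
  ∃ M : G.Subgraph, M.IsPerfectMatching

/-- `G` has a near perfect matching: a matching covering all vertices but exactly one. -/
def HasNearPerfectMatching {V : Type*} (G : SimpleGraph V) : Prop :=
  ∃ M : G.Subgraph, M.IsMatching ∧ ∃ v : V, M.verts = {v}ᶜ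

/-- The exceptional graph on nine vertices: independent vertices `s 0, s 1, s 2` (left) and
independent vertices `c j e` with `j : Fin 3`, `e : Fin 2` (right), with `s i` adjacent to
`c j e` exactly when `i ≠ j`. -/
def exceptional9 : SimpleGraph (Fin 3 ⊕ Fin 3 × Fin 2) where
  Adj
    | .inl i, .inr p => i ≠ p.1
    | .inr p, .inl i => i ≠ p.1
    | _, _ => False
  symm := ⟨by rintro (i | p) (j | q) h <;> exact h⟩
  loopless := ⟨by rintro (i | p) h <;> exact h⟩

/-- The graph on fifteen vertices built from a graph `H` on `A ∪ B`, where `A` and `B` are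
disjoint of size three: keep `H` on `A ∪ B`, and add nine pairwise non-adjacent new vertices
`x a b`, one for each `(a, b)` in `A × B`, with `x a b` adjacent to exactly the four vertices of
`A ∪ B` other than `a` and `b`. -/
def exceptional15 (H : SimpleGraph (Fin 3 ⊕ Fin 3)) :
    SimpleGraph ((Fin 3 ⊕ Fin 3) ⊕ Fin 3 × Fin 3) where
  Adj
    | .inl s, .inl t => H.Adj s t
    | .inl s, .inr p => s ≠ .inl p.1 ∧ s ≠ .inr p.2
    | .inr p, .inl s => s ≠ .inl p.1 ∧ s ≠ .inr p.2
    | .inr _, .inr _ => False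
  symm := ⟨by
    rintro (s | p) (t | q) h
    · exact H.adj_symm h
    · exact h
    · exact h
    · exact h⟩
  loopless := ⟨by
    rintro (s | p) h
    · exact H.irrefl h
    · exact h⟩

/-- The triangular prism: two triangles joined by a perfect matching. -/
def prism : SimpleGraph (Fin 3 ⊕ Fin 3) where
  Adj
    | .inl a, .inl b => a ≠ b
    | .inr a, .inr b => a ≠ b
    | .inl a, .inr b => a = b
    | .inr a, .inl b => a = b
  symm := ⟨by rintro (a | a) (b | b) h <;> exact h.symm⟩
  loopless := ⟨by rintro (a | a) h <;> exact h rfl⟩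

end DomCrit

/-! Criticality gives every vertex `v` a critical pair: two vertices, neither adjacent to `v`, that
dominate everything except `v`. If the desired matching does not exist, Tutte's theorem (applied to
the cone over `G` when the order is odd) yields a set `S` whose removal leaves at least `#S + 2`,
respectively `#S + 3`, odd parts. With this many parts a critical pair almost always meets `S`, and
it does so in one of two ways.

An outer pair `{a, b}` has only `a` in `S`. Then `b` dominates nothing outside `S` beyond its own
part, so `a` is joined completely to all but at most two parts. Since `a` has neighbours in fewer
than `r` parts of a `K_{1,r}`-free graph, outer pairs need at most `r + 1` parts. An inner pair lies
in `S`. It determines the vertex it belongs to, so at most `(#S).choose 2` vertices have one.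

The rest is a tension between these counts as `#S` grows. Sets with at most two vertices leave no
room for the pairs. For `#S = 3` the parts not fully joined to the vertices of `S` are so few that
some part is even or the graph is `exceptional9`. The value 4 dies in `card_S_ne_four`, and 5 in
`card_S_ne_five`, where the orders 12 and 13 are those at which every part could be a single vertex.
For `#S ≥ 6` all pairs are inner and form a graph on `S` with one edge for each vertex of `G`;
`card_S_le_six` plays its edge count against the many non-neighbours that star-freeness forces on
each vertex of `S`. The only survivor has `#S = 6` and order `15 = choose 6 2`. There every pair of
`S` is used, so non-adjacency inside `S` is 2-regular: two triangles or a hexagon, which gives the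
two graphs of `nonempty_iso_exceptional15`. -/

namespace DomCrit

open Finset
open scoped Classical

noncomputable section

/-! ### Critical pairs, induced stars and a parity criterion -/

section Basic

variable {V : Type*} {G : SimpleGraph V}

/-- `{a, b}` is a pair of vertices away from `v` dominating every vertex except `v`. -/
structure CriticalPair (G : SimpleGraph V) (v a b : V) : Prop where
  ne : a ≠ b
  ne_left : a ≠ v
  ne_right : b ≠ v
  not_adj_left : ¬G.Adj a v
  not_adj_right : ¬G.Adj b v
  dominates : ∀ x, x ≠ v → x = a ∨ x = b ∨ G.Adj a x ∨ G.Adj b x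

lemma CriticalPair.symm {v a b : V} (h : CriticalPair G v a b) : CriticalPair G v b a :=
  ⟨h.ne.symm, h.ne_right, h.ne_left, h.not_adj_right, h.not_adj_left, fun x hx => by
    have := h.dominates x hx
    tauto⟩

lemma dominationNumber_le {D : Finset V} (h : IsDominatingSet G D) :
    dominationNumber G ≤ #D :=
  Nat.sInf_le ⟨D, h, rfl⟩

lemma exists_isDominatingSet_card [Fintype V] (G : SimpleGraph V) :
    ∃ D : Finset V, IsDominatingSet G D ∧ #D = dominationNumber G :=
  Nat.sInf_mem (s := {n : ℕ | ∃ D : Finset V, IsDominatingSet G D ∧ D.card = n})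
    ⟨_, univ, fun v => Or.inl (mem_univ v), rfl⟩

/-- A dominating set of `G - v` with at most two vertices becomes dominating in `G` once `v` is
added, so it has exactly two; a neighbour of `v` in it would make it dominate `G` by itself. -/
lemma exists_criticalPair [Fintype V] (hG : IsGammaVertexCritical 3 G) (v : V) :
    ∃ a b, CriticalPair G v a b := by
  obtain ⟨h3, hcrit⟩ := hG
  obtain ⟨D, hD, hcard⟩ := exists_isDominatingSet_card (G.induce {v}ᶜ)
  have hlt := hcrit v
  rw [← hcard, h3] at hlt
  have hbig : ∀ E : Finset V, IsDominatingSet G E → 3 ≤ #E := fun E hE =>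
    h3 ▸ dominationNumber_le hE
  set D' : Finset V := D.map (Function.Embedding.subtype _) with hD'
  have hdom : ∀ x, x ≠ v → x ∈ D' ∨ ∃ u ∈ D', G.Adj u x := by
    intro x hx
    rcases hD ⟨x, hx⟩ with h | ⟨u, hu, hux⟩
    · exact Or.inl (mem_map.2 ⟨_, h, rfl⟩)
    · exact Or.inr ⟨u, mem_map.2 ⟨_, hu, rfl⟩, hux⟩
  have hvD : ∀ x ∈ D', x ≠ v := by
    intro x hx
    obtain ⟨y, -, rfl⟩ := mem_map.1 hx
    exact y.2
  have hcD : #D' = #D := card_map _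
  have hcard2 : #D' = 2 := by
    have h := hbig (insert v D') (by
      intro x
      by_cases hx : x = v
      · exact Or.inl (by simp [hx])
      · rcases hdom x hx with h | ⟨u, hu, hux⟩
        · exact Or.inl (mem_insert_of_mem h)
        · exact Or.inr ⟨u, mem_insert_of_mem hu, hux⟩)
    have := card_insert_le v D'
    omega
  have hnadj : ∀ x ∈ D', ¬G.Adj x v := by
    intro x hx hxv
    have h := hbig D' (by
      intro y
      by_cases hy : y = v
      · exact Or.inr ⟨x, hx, hy ▸ hxv⟩
      · exact hdom y hy)
    omega
  obtain ⟨a, b, hab, hE⟩ := card_eq_two.1 hcard2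
  have ha : a ∈ D' := by simp [hE]
  have hb : b ∈ D' := by simp [hE]
  refine ⟨a, b, hab, hvD a ha, hvD b hb, hnadj a ha, hnadj b hb, fun x hx => ?_⟩
  have := hdom x hx
  simp only [hE, mem_insert, mem_singleton, exists_eq_or_imp, exists_eq_left] at this
  tauto

lemma card_lt_of_isStarFree {r : ℕ} (hG : IsStarFree r G) (a : V) (T : Finset V)
    (hadj : ∀ t ∈ T, G.Adj a t) (hind : ∀ t ∈ T, ∀ u ∈ T, ¬G.Adj t u) : #T < r := by
  by_contra! hle
  obtain ⟨U, hUT, hU⟩ := exists_subset_card_eq hle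
  apply hG
  let e : Fin r ≃ U := (U.equivFinOfCardEq hU).symm
  have he : ∀ i, (e i : V) ∈ T := fun i => hUT (e i).2
  refine ⟨⟨⟨Sum.elim (fun _ => a) (fun i => (e i : V)), ?_⟩, ?_⟩⟩
  · rintro (i | i) (j | j) h
    · simp [Subsingleton.elim i j]
    · simp only [Sum.elim_inl, Sum.elim_inr] at h
      exact absurd (hadj _ (he j)) (by rw [← h]; exact G.irrefl)
    · simp only [Sum.elim_inl, Sum.elim_inr] at h
      exact absurd (hadj _ (he i)) (by rw [h]; exact G.irrefl)
    · simp only [Sum.elim_inr] at h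
      rw [e.injective (Subtype.ext h)]
  · rintro (i | i) (j | j)
    · change G.Adj a a ↔ _
      simp
    · change G.Adj a (e j) ↔ _
      simpa using hadj _ (he j)
    · change G.Adj (e i) a ↔ _
      simpa using (hadj _ (he i)).symm
    · change G.Adj (e i) (e j) ↔ _
      simpa using hind _ (he i) _ (he j)

/-- A set in which every vertex has exactly one non-neighbour has even size. -/
lemma even_card_of_exists_unique_nonadj (C : Finset V)
    (h : ∀ w ∈ C, ∃ b ∈ C, b ≠ w ∧ ¬G.Adj b w ∧ ∀ x ∈ C, x ≠ w → x = b ∨ G.Adj b x) :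
    Even #C := by
  choose! f hfC hne hnadj hdom using h
  have hinv : ∀ w ∈ C, f (f w) = w := by
    intro w hw
    by_contra hcon
    have h1 := hfC w hw
    rcases hdom w hw (f (f w)) (hfC _ h1) hcon with h2 | h2
    · exact hne _ h1 h2
    · exact hnadj _ h1 h2.symm
  -- `f` is a fixed-point-free involution on `C`, so the ones cancel in pairs.
  have hsum : ∑ _w ∈ C, (1 : ZMod 2) = 0 :=
    Finset.sum_involution (fun w _ => f w) (fun _ _ => by decide)
      (fun w hw _ => hne w hw) (fun w hw => hfC w hw) (fun w hw => hinv w hw)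
  rw [sum_const, nsmul_eq_mul, mul_one] at hsum
  exact (ZMod.natCast_eq_zero_iff_even).1 hsum

end Basic

/-! ### Vertex cuts with labelled parts -/

/-- A set `S` of vertices, with a labelling of the remaining vertices that is constant along the
edges avoiding `S`. -/
structure LabelledCut {V : Type*} (G : SimpleGraph V) (κ : Type*) where
  S : Finset V
  label : V → κ
  label_eq : ∀ ⦃u v⦄, u ∉ S → v ∉ S → G.Adj u v → label u = label v

namespace LabelledCut

variable {V κ : Type*} [Fintype V] {G : SimpleGraph V} (X : LabelledCut G κ)

/-- The labels of the vertices outside `S`. -/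
def labels : Finset κ := X.Sᶜ.image X.label

/-- The vertices outside `S` with a given label. -/
def fiber (i : κ) : Finset V := {v | v ∉ X.S ∧ X.label v = i}

def oddLabels : Finset κ := {i ∈ X.labels | Odd #(X.fiber i)}

variable {X}

@[simp] lemma mem_fiber {i : κ} {v : V} : v ∈ X.fiber i ↔ v ∉ X.S ∧ X.label v = i := by
  simp [fiber]

lemma mem_labels {i : κ} : i ∈ X.labels ↔ ∃ v, v ∉ X.S ∧ X.label v = i := by
  simp [labels]

lemma label_mem {v : V} (hv : v ∉ X.S) : X.label v ∈ X.labels := mem_labels.2 ⟨v, hv, rfl⟩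

variable (X)

lemma oddLabels_subset : X.oddLabels ⊆ X.labels := filter_subset _ _

lemma card_oddLabels_le : #X.oddLabels ≤ #X.labels := card_le_card X.oddLabels_subset

lemma sum_card_fiber : ∑ i ∈ X.labels, #(X.fiber i) = #X.Sᶜ := by
  have h := card_eq_sum_card_fiberwise (s := X.Sᶜ) (f := X.label) (t := X.labels)
    (fun v hv => label_mem (by simpa using hv))
  rw [h]
  refine sum_congr rfl fun i _ => congrArg card ?_
  ext v
  simp

lemma card_add_card_compl : #X.S + #X.Sᶜ = Fintype.card V :=
  Finset.card_add_card_compl _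

lemma odd_card_oddLabels : Odd #X.oddLabels ↔ Odd #X.Sᶜ := by
  rw [← X.sum_card_fiber, odd_sum_iff_odd_card_odd]
  rfl

lemma even_card_add_card_oddLabels (h : Even (Fintype.card V)) :
    Even (#X.S + #X.oddLabels) := by
  have h1 := X.odd_card_oddLabels
  have h2 := X.card_add_card_compl
  rw [← h2] at h
  simp only [Nat.even_add, ← Nat.not_even_iff_odd] at *
  tauto

end LabelledCut

/-! ### Cuts from Tutte's theorem, for even and odd order -/

section Tutte

variable {V : Type*}

lemma exists_labelledCut_of_isTutteViolator [Fintype V] (G : SimpleGraph V) (U : Set V)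
    (hU : G.IsTutteViolator U) :
    ∃ X : LabelledCut G V, #X.S < #X.oddLabels := by
  set H := ((⊤ : G.Subgraph).deleteVerts U) with hH
  have hmem : ∀ v, v ∈ H.verts ↔ v ∉ U := by simp [hH]
  -- A vertex outside `U` is labelled by a chosen representative of its component; the value on `U`
  -- is irrelevant.
  let lab : V → V := fun v => if h : v ∈ H.verts then
    ((H.coe.connectedComponentMk ⟨v, h⟩).out : V) else v
  have hlab : ∀ v (h : v ∈ H.verts), lab v = ((H.coe.connectedComponentMk ⟨v, h⟩).out : V) :=
    fun v h => by simp [lab, h]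
  let X : LabelledCut G V :=
    { S := U.toFinset
      label := lab
      label_eq := by
        intro u v hu hv huv
        have hu' : u ∈ H.verts := by simpa [hmem] using hu
        have hv' : v ∈ H.verts := by simpa [hmem] using hv
        rw [hlab u hu', hlab v hv']
        congr 2
        apply SimpleGraph.ConnectedComponent.sound
        apply SimpleGraph.Adj.reachable
        have h1 := (hmem u).1 hu'
        have h2 := (hmem v).1 hv'
        simp [hH, huv, h1, h2] }
  have hS : ∀ v, v ∉ X.S ↔ v ∈ H.verts := by simp [X, hmem]
  have hfib : ∀ C : H.coe.ConnectedComponent,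
      X.fiber (C.out : V) = C.supp.toFinset.map (Function.Embedding.subtype _) := by
    intro C
    ext v
    simp only [LabelledCut.mem_fiber, hS, mem_map, Set.mem_toFinset,
      SimpleGraph.ConnectedComponent.mem_supp_iff, Function.Embedding.subtype_apply,
      Subtype.exists, exists_and_right, exists_eq_right]
    constructor
    · rintro ⟨hv, h⟩
      refine ⟨hv, ?_⟩
      have h' : lab v = (C.out : V) := h
      rw [hlab v hv] at h'
      have h2 := Subtype.ext h'
      rw [← Quot.out_eq (H.coe.connectedComponentMk ⟨v, hv⟩), ← Quot.out_eq C]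
      exact congrArg _ h2
    · rintro ⟨hv, h⟩
      refine ⟨hv, ?_⟩
      change lab v = _
      rw [hlab v hv, h]
  refine ⟨X, ?_⟩
  have h1 : #X.S = U.ncard := by simp [X, Set.ncard_eq_toFinset_card']
  rw [h1]
  refine lt_of_lt_of_le hU ?_
  rw [Set.ncard_eq_toFinset_card']
  refine card_le_card_of_injOn (fun C => (C.out : V)) ?_ ?_
  · intro C hC
    have hC' : Odd C.supp.ncard := by simpa using hC
    have : Odd #(X.fiber (C.out : V)) := by
      rw [hfib, card_map, ← Set.ncard_eq_toFinset_card']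
      exact hC'
    simp only [mem_coe, LabelledCut.oddLabels, mem_filter]
    refine ⟨?_, this⟩
    obtain ⟨v, hv⟩ := card_pos.1 this.pos
    rw [LabelledCut.mem_labels]
    exact ⟨v, by simpa using hv⟩
  · intro C _ C' _ h
    have h2 := Subtype.ext h
    rw [← Quot.out_eq C, ← Quot.out_eq C']
    exact congrArg _ h2

/-- `#X.S` and `#X.oddLabels` have the same parity when the order is even, so an excess of one is an
excess of two. -/
lemma exists_labelledCut [Fintype V] (G : SimpleGraph V) (hV : Even (Fintype.card V))
    (h : ¬HasPerfectMatching G) : ∃ X : LabelledCut G V, #X.S + 2 ≤ #X.oddLabels := by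
  have h' : ¬∀ u, ¬G.IsTutteViolator u := fun h2 => h (SimpleGraph.tutte.2 h2)
  push Not at h'
  obtain ⟨U, hU⟩ := h'
  obtain ⟨X, hX⟩ := exists_labelledCut_of_isTutteViolator G U hU
  refine ⟨X, ?_⟩
  have := X.even_card_add_card_oddLabels hV
  rw [Nat.even_iff] at this
  omega

/-- The cone over `G`: a new vertex `none` is joined to every vertex of `G`. -/
def cone (G : SimpleGraph V) : SimpleGraph (Option V) where
  Adj x y := x ≠ y ∧ ∀ u v, x = some u → y = some v → G.Adj u v
  symm := ⟨fun _ _ h => ⟨h.1.symm, fun u v hu hv => (h.2 v u hv hu).symm⟩⟩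
  loopless := ⟨fun _ h => h.1 rfl⟩

lemma cone_adj_some {G : SimpleGraph V} {u v : V} :
    (cone G).Adj (some u) (some v) ↔ G.Adj u v := by
  constructor
  · intro h
    exact h.2 u v rfl rfl
  · intro h
    refine ⟨by simpa using h.ne, ?_⟩
    rintro _ _ ⟨⟩ ⟨⟩
    exact h

lemma cone_adj_none {G : SimpleGraph V} {u : V} : (cone G).Adj none (some u) :=
  ⟨by simp, by rintro _ _ ⟨⟩⟩

lemma hasNearPerfectMatching_of_cone {G : SimpleGraph V} (h : HasPerfectMatching (cone G)) :
    HasNearPerfectMatching G := by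
  obtain ⟨M, hM⟩ := h
  rw [SimpleGraph.Subgraph.isPerfectMatching_iff] at hM
  obtain ⟨o, ho, -⟩ := hM none
  cases o with
  | none => exact absurd ho.adj_sub (cone G).irrefl
  | some w =>
    refine ⟨⟨{w}ᶜ, fun x y => M.Adj (some x) (some y), fun h => cone_adj_some.1 h.adj_sub, ?_,
      ⟨fun _ _ h => h.symm⟩⟩, ?_, w, rfl⟩
    · intro x y hxy hx
      obtain rfl : x = w := hx
      exact Option.some_ne_none y ((hM (some x)).unique hxy ho.symm)
    · intro x hx
      obtain ⟨o, ho', huni⟩ := hM (some x)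
      cases o with
      | none =>
        exact absurd (Option.some.inj ((hM none).unique ho'.symm ho)) hx
      | some y =>
        exact ⟨y, ho', fun z hz => Option.some.inj (huni _ hz)⟩

/-- The cone has even order and no perfect matching. Its apex must lie in the Tutte set; deleting it
from that set turns an excess of two into three. -/
lemma exists_labelledCut_of_odd [Fintype V] (G : SimpleGraph V) (hV : Odd (Fintype.card V))
    (h : ¬HasNearPerfectMatching G) :
    ∃ X : LabelledCut G (Option V), #X.S + 3 ≤ #X.oddLabels := by
  have hV' : Even (Fintype.card (Option V)) := by
    rw [Fintype.card_option]
    exact hV.add_one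
  obtain ⟨Y, hY⟩ := exists_labelledCut (cone G) hV' fun h' =>
    h (hasNearPerfectMatching_of_cone h')
  by_cases hnone : none ∈ Y.S
  · let X : LabelledCut G (Option V) :=
      { S := {v | some v ∈ Y.S}
        label := fun v => Y.label (some v)
        label_eq := fun u v hu hv huv =>
          Y.label_eq (by simpa using hu) (by simpa using hv) (cone_adj_some.2 huv) }
    have hfib : ∀ i, Y.fiber i = (X.fiber i).map Function.Embedding.some := by
      intro i
      ext o
      cases o with
      | none => simp [hnone]
      | some v => simp [X]
    have hlabels : Y.labels ⊆ X.labels := by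
      intro i hi
      obtain ⟨o, ho, rfl⟩ := LabelledCut.mem_labels.1 hi
      cases o with
      | none => exact absurd hnone ho
      | some v => exact LabelledCut.mem_labels.2 ⟨v, by simpa [X] using ho, rfl⟩
    have hodd : Y.oddLabels ⊆ X.oddLabels := by
      intro i hi
      simp only [LabelledCut.oddLabels, mem_filter] at hi ⊢
      refine ⟨hlabels hi.1, ?_⟩
      have := hi.2
      rwa [hfib, card_map] at this
    have hS : Y.S = insert none (X.S.map Function.Embedding.some) := by
      ext o
      cases o with
      | none => simp [hnone]
      | some v => simp [X]
    have hcS : #Y.S = #X.S + 1 := by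
      rw [hS, card_insert_of_notMem (by simp), card_map]
    exact ⟨X, by have := card_le_card hodd; omega⟩
  -- An apex outside the set is adjacent to every other vertex, so there is only one label.
  · exfalso
    have hlab : ∀ i ∈ Y.labels, i = Y.label none := by
      intro i hi
      obtain ⟨o, ho, rfl⟩ := LabelledCut.mem_labels.1 hi
      cases o with
      | none => rfl
      | some v => exact (Y.label_eq hnone ho cone_adj_none).symm
    have h1 : #Y.labels ≤ 1 := card_le_one.2 fun a ha b hb => by rw [hlab a ha, hlab b hb]
    have := Y.card_oddLabels_le
    omega

end Tutte

/-! ### Outer and inner critical pairs of a cut -/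

namespace LabelledCut

variable {V κ : Type*} [Fintype V] {G : SimpleGraph V} (X : LabelledCut G κ)

/-- The vertices of `S` different from and not adjacent to `u`. -/
def missing (u : V) : Finset V := {a ∈ X.S | a ≠ u ∧ ¬G.Adj a u}

/-- The labels of the vertices outside `S` that are not adjacent to `a`. -/
def deficient (a : V) : Finset κ := {i ∈ X.labels | ∃ w ∈ X.fiber i, ¬G.Adj a w}

/-- The labels of the vertices outside `S` that are adjacent to `a`. -/
def touched (a : V) : Finset κ := {i ∈ X.labels | ∃ w ∈ X.fiber i, G.Adj a w}

/-- Some critical pair for `u` has exactly one vertex in `S`. -/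
def Outer (u : V) : Prop := ∃ a b, CriticalPair G u a b ∧ a ∈ X.S ∧ b ∉ X.S

/-- Some critical pair for `u` lies in `S`. -/
def Inner (u : V) : Prop := ∃ a b, CriticalPair G u a b ∧ a ∈ X.S ∧ b ∈ X.S

variable {X}

omit [Fintype V] in
lemma mem_missing {a u : V} : a ∈ X.missing u ↔ a ∈ X.S ∧ a ≠ u ∧ ¬G.Adj a u := by
  simp [missing]

omit [Fintype V] in
lemma mem_missing_comm {a u : V} (hu : u ∈ X.S) (h : a ∈ X.missing u) : u ∈ X.missing a := by
  rw [mem_missing] at h ⊢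
  exact ⟨hu, h.2.1.symm, fun h' => h.2.2 h'.symm⟩

omit [Fintype V] in
lemma missing_subset (u : V) : X.missing u ⊆ X.S := filter_subset _ _

omit [Fintype V] in
lemma notMem_missing_self (u : V) : u ∉ X.missing u := by simp [mem_missing]

lemma mem_deficient {a : V} {i : κ} :
    i ∈ X.deficient a ↔ ∃ w, w ∉ X.S ∧ X.label w = i ∧ ¬G.Adj a w := by
  simp only [deficient, mem_filter, mem_labels, mem_fiber]
  constructor
  · rintro ⟨-, w, ⟨h1, h2⟩, h3⟩
    exact ⟨w, h1, h2, h3⟩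
  · rintro ⟨w, h1, h2, h3⟩
    exact ⟨⟨w, h1, h2⟩, w, ⟨h1, h2⟩, h3⟩

lemma mem_touched {a : V} {i : κ} :
    i ∈ X.touched a ↔ ∃ w, w ∉ X.S ∧ X.label w = i ∧ G.Adj a w := by
  simp only [touched, mem_filter, mem_labels, mem_fiber]
  constructor
  · rintro ⟨-, w, ⟨h1, h2⟩, h3⟩
    exact ⟨w, h1, h2, h3⟩
  · rintro ⟨w, h1, h2, h3⟩
    exact ⟨⟨w, h1, h2⟩, w, ⟨h1, h2⟩, h3⟩

lemma deficient_subset_labels (a : V) : X.deficient a ⊆ X.labels := filter_subset _ _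

lemma label_mem_deficient {a u : V} (hu : u ∉ X.S) (h : ¬G.Adj a u) :
    X.label u ∈ X.deficient a := mem_deficient.2 ⟨u, hu, rfl, h⟩

lemma adj_of_notMem_deficient {a w : V} (hw : w ∉ X.S) (h : X.label w ∉ X.deficient a) :
    G.Adj a w := by
  by_contra h'
  exact h (label_mem_deficient hw h')

lemma labels_sdiff_deficient_subset (a : V) : X.labels \ X.deficient a ⊆ X.touched a := by
  intro i hi
  rw [mem_sdiff] at hi
  obtain ⟨w, hw, rfl⟩ := mem_labels.1 hi.1
  exact mem_touched.2 ⟨w, hw, rfl, adj_of_notMem_deficient hw hi.2⟩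

lemma card_labels_le (a : V) : #X.labels ≤ #(X.deficient a) + #(X.touched a) := by
  have h1 := card_le_card (labels_sdiff_deficient_subset (X := X) a)
  have h2 := card_sdiff_add_card_eq_card (deficient_subset_labels (X := X) a)
  omega

/-- One neighbour of `a` from each touched label gives an induced star, as different labels are
never adjacent. -/
lemma card_touched_lt {r : ℕ} (hG : IsStarFree r G) (a : V) : #(X.touched a) < r := by
  have h : ∀ i ∈ X.touched a, ∃ w, w ∉ X.S ∧ X.label w = i ∧ G.Adj a w :=
    fun i hi => mem_touched.1 hi
  have hne : Nonempty V := ⟨a⟩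
  choose! f hf1 hf2 hf3 using h
  have hinj : Set.InjOn f (X.touched a) := by
    intro i hi j hj hij
    rw [← hf2 i hi, ← hf2 j hj, hij]
  rw [← card_image_of_injOn hinj]
  refine card_lt_of_isStarFree hG a _ ?_ ?_
  · intro t ht
    obtain ⟨i, hi, rfl⟩ := mem_image.1 ht
    exact hf3 i hi
  · intro t ht u hu htu
    obtain ⟨i, hi, rfl⟩ := mem_image.1 ht
    obtain ⟨j, hj, rfl⟩ := mem_image.1 hu
    have h := X.label_eq (hf1 i hi) (hf1 j hj) htu
    rw [hf2 i hi, hf2 j hj] at h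
    subst h
    exact G.irrefl htu

-- Outside `S`, the vertex `b` dominates only vertices of its own label; all others except `u` are
-- left to `a`.
omit [Fintype V] in
lemma adj_of_criticalPair {u a b w : V} (h : CriticalPair G u a b) (ha : a ∈ X.S)
    (hb : b ∉ X.S) (hw : w ∉ X.S) (hwu : w ≠ u) (hl : X.label w ≠ X.label b) : G.Adj a w := by
  rcases h.dominates w hwu with rfl | rfl | h1 | h1
  · exact absurd ha hw
  · exact absurd rfl hl
  · exact h1
  · exact absurd (X.label_eq hw hb h1.symm) hl

lemma deficient_subset_of_criticalPair_mem {u a b : V} (h : CriticalPair G u a b)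
    (ha : a ∈ X.S) (hb : b ∉ X.S) (hu : u ∈ X.S) : X.deficient a ⊆ {X.label b} := by
  intro i hi
  obtain ⟨w, hw, rfl, hnw⟩ := mem_deficient.1 hi
  by_contra hl
  exact hnw (adj_of_criticalPair h ha hb hw (by rintro rfl; exact hw hu) (by simpa using hl))

lemma deficient_subset_of_criticalPair {u a b : V} (h : CriticalPair G u a b)
    (ha : a ∈ X.S) (hb : b ∉ X.S) : X.deficient a ⊆ {X.label u, X.label b} := by
  intro i hi
  obtain ⟨w, hw, rfl, hnw⟩ := mem_deficient.1 hi
  by_contra hl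
  simp only [mem_insert, mem_singleton, not_or] at hl
  exact hnw (adj_of_criticalPair h ha hb hw (by rintro rfl; exact hl.1 rfl) hl.2)

omit [Fintype V] in
lemma left_mem_missing {u a b : V} (h : CriticalPair G u a b) (ha : a ∈ X.S) :
    a ∈ X.missing u := mem_missing.2 ⟨ha, h.ne_left, h.not_adj_left⟩

-- A critical pair fails to dominate exactly one vertex, so it identifies that vertex. This makes
-- the assignment of inner pairs injective.
omit [Fintype V] in
lemma eq_of_criticalPair_of_missing {u u' a b : V} (h : CriticalPair G u a b)
    (ha : a ∈ X.missing u') (hb : b ∈ X.missing u') : u' = u := by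
  by_contra hne
  rw [mem_missing] at ha hb
  rcases h.dominates u' hne with h1 | h1 | h1 | h1
  · exact ha.2.1 h1.symm
  · exact hb.2.1 h1.symm
  · exact ha.2.2 h1
  · exact hb.2.2 h1

omit [Fintype V] in
lemma outer_or_inner_of_exists_label {u : V} (hD : ∀ v, ∃ a b, CriticalPair G v a b)
    (hk : ∀ i j, ∃ w, w ∉ X.S ∧ w ≠ u ∧ X.label w ≠ i ∧ X.label w ≠ j) :
    X.Outer u ∨ X.Inner u := by
  obtain ⟨a, b, h⟩ := hD u
  by_cases ha : a ∈ X.S <;> by_cases hb : b ∈ X.S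
  · exact Or.inr ⟨a, b, h, ha, hb⟩
  · exact Or.inl ⟨a, b, h, ha, hb⟩
  · exact Or.inl ⟨b, a, h.symm, hb, ha⟩
  · obtain ⟨w, hw, hwu, hwa, hwb⟩ := hk (X.label a) (X.label b)
    rcases h.dominates w hwu with rfl | rfl | h1 | h1
    · exact absurd rfl hwa
    · exact absurd rfl hwb
    · exact absurd (X.label_eq hw ha h1.symm) hwa
    · exact absurd (X.label_eq hw hb h1.symm) hwb

lemma exists_label_notMem (T : Finset κ) (h : #T < #X.labels) :
    ∃ w, w ∉ X.S ∧ X.label w ∉ T := by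
  obtain ⟨i, hi, hT⟩ := exists_mem_notMem_of_card_lt_card h
  obtain ⟨w, hw, rfl⟩ := mem_labels.1 hi
  exact ⟨w, hw, hT⟩

lemma outer_or_inner (hD : ∀ v, ∃ a b, CriticalPair G v a b) (hk : 4 ≤ #X.labels) (u : V) :
    X.Outer u ∨ X.Inner u := by
  refine outer_or_inner_of_exists_label hD fun i j => ?_
  obtain ⟨w, hw, h⟩ := X.exists_label_notMem {X.label u, i, j} (by
    have := card_le_three (a := X.label u) (b := i) (c := j)
    omega)
  simp only [mem_insert, mem_singleton, not_or] at h
  exact ⟨w, hw, by rintro rfl; exact h.1 rfl, h.2.1, h.2.2⟩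

lemma outer_or_inner_of_mem (hD : ∀ v, ∃ a b, CriticalPair G v a b) (hk : 3 ≤ #X.labels)
    {u : V} (hu : u ∈ X.S) : X.Outer u ∨ X.Inner u := by
  refine outer_or_inner_of_exists_label hD fun i j => ?_
  obtain ⟨w, hw, h⟩ := X.exists_label_notMem {i, j} (by
    have := card_le_two (a := i) (b := j)
    omega)
  simp only [mem_insert, mem_singleton, not_or] at h
  exact ⟨w, hw, by rintro rfl; exact hw hu, h.1, h.2⟩

lemma missing_nonempty (hD : ∀ v, ∃ a b, CriticalPair G v a b) (hk : 4 ≤ #X.labels) (u : V) :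
    (X.missing u).Nonempty := by
  rcases outer_or_inner hD hk u with ⟨a, b, h, ha, -⟩ | ⟨a, b, h, ha, -⟩ <;>
  exact ⟨a, left_mem_missing h ha⟩

lemma labels_subset_biUnion_deficient (hD : ∀ v, ∃ a b, CriticalPair G v a b)
    (hk : 4 ≤ #X.labels) : X.labels ⊆ X.S.biUnion X.deficient := by
  intro i hi
  obtain ⟨w, hw, rfl⟩ := mem_labels.1 hi
  obtain ⟨a, ha⟩ := missing_nonempty hD hk w
  rw [mem_missing] at ha
  exact mem_biUnion.2 ⟨a, ha.1, label_mem_deficient hw ha.2.2⟩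

omit [Fintype V] in
/-- The critical pairs in `S` form an injective family of two-element sets. -/
lemma exists_pairs (U : Finset V) (h : ∀ u ∈ U, X.Inner u) :
    ∃ p : V → Finset V, ∀ u ∈ U, #(p u) = 2 ∧ p u ⊆ X.missing u ∧
      ∀ u', p u ⊆ X.missing u' → u' = u := by
  have h' : ∀ u ∈ U, ∃ p : Finset V, #p = 2 ∧ p ⊆ X.missing u ∧
      ∀ u', p ⊆ X.missing u' → u' = u := by
    intro u hu
    obtain ⟨a, b, hab, ha, hb⟩ := h u hu
    refine ⟨{a, b}, card_pair hab.ne, ?_, fun u' hu' => ?_⟩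
    · simp only [insert_subset_iff, singleton_subset_iff]
      exact ⟨left_mem_missing hab ha, left_mem_missing hab.symm hb⟩
    · exact eq_of_criticalPair_of_missing hab (hu' (by simp)) (hu' (by simp))
  choose! p hp using h'
  exact ⟨p, hp⟩

omit [Fintype V] in
lemma injOn_pairs {U : Finset V} {p : V → Finset V}
    (hp : ∀ u ∈ U, #(p u) = 2 ∧ p u ⊆ X.missing u ∧ ∀ u', p u ⊆ X.missing u' → u' = u) :
    Set.InjOn p U := by
  intro u hu v hv huv
  exact ((hp u hu).2.2 v (huv ▸ (hp v hv).2.1)).symm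

omit [Fintype V] in
lemma image_pairs_subset {U : Finset V} {p : V → Finset V}
    (hp : ∀ u ∈ U, #(p u) = 2 ∧ p u ⊆ X.missing u ∧ ∀ u', p u ⊆ X.missing u' → u' = u) :
    U.image p ⊆ powersetCard 2 X.S := by
  intro e he
  obtain ⟨u, hu, rfl⟩ := mem_image.1 he
  exact mem_powersetCard.2 ⟨(hp u hu).2.1.trans (missing_subset u), (hp u hu).1⟩

omit [Fintype V] in
lemma card_le_choose_of_inner (U : Finset V) (h : ∀ u ∈ U, X.Inner u) :
    #U ≤ (#X.S).choose 2 := by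
  obtain ⟨p, hp⟩ := exists_pairs U h
  rw [← card_image_of_injOn (injOn_pairs hp), ← card_powersetCard]
  exact card_le_card (image_pairs_subset hp)

lemma card_labels_le_card_compl : #X.labels ≤ #X.Sᶜ := card_image_le

/-- A label outside the deficient sets of size at most two contributes a critical pair among the
remaining vertices of `S`. -/
lemma card_labels_le_sum_add_choose (hD : ∀ v, ∃ a b, CriticalPair G v a b)
    (hk : 4 ≤ #X.labels) :
    #X.labels ≤ ∑ a ∈ X.S with #(X.deficient a) ≤ 2, #(X.deficient a) +
      (#{a ∈ X.S | ¬#(X.deficient a) ≤ 2}).choose 2 := by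
  set W := {a ∈ X.S | #(X.deficient a) ≤ 2} with hW
  set Z := {a ∈ X.S | ¬#(X.deficient a) ≤ 2} with hZ
  have h1 : #X.labels ≤ #(W.biUnion X.deficient) + #(X.labels \ W.biUnion X.deficient) := by
    rw [← card_union_of_disjoint disjoint_sdiff, union_sdiff_self_eq_union]
    exact card_le_card subset_union_right
  refine h1.trans (add_le_add card_biUnion_le ?_)
  have h2 : ∀ i ∈ X.labels \ W.biUnion X.deficient, ∃ u, X.label u = i ∧
      ∃ a b, CriticalPair G u a b ∧ a ∈ Z ∧ b ∈ Z := by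
    intro i hi
    rw [mem_sdiff] at hi
    obtain ⟨w, hw, rfl⟩ := mem_labels.1 hi.1
    have hZmem : ∀ a ∈ X.S, ¬G.Adj a w → a ∈ Z := by
      intro a ha haw
      refine mem_filter.2 ⟨ha, fun h => hi.2 (mem_biUnion.2 ⟨a, mem_filter.2 ⟨ha, h⟩, ?_⟩)⟩
      exact label_mem_deficient hw haw
    rcases outer_or_inner hD hk w with ⟨a, b, h, ha, hb⟩ | ⟨a, b, h, ha, hb⟩
    -- The centre of an outer pair has at most two deficient labels, so it cannot lie in `Z`.
    · exfalso
      have h3 := (mem_filter.1 (hZmem a ha h.not_adj_left)).2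
      exact h3 ((card_le_card (deficient_subset_of_criticalPair h ha hb)).trans card_le_two)
    · exact ⟨w, rfl, a, b, h, hZmem a ha h.not_adj_left, hZmem b hb h.not_adj_right⟩
  have hne : Nonempty V := by
    obtain ⟨i, hi⟩ := card_pos.1 (by omega : 0 < #X.labels)
    exact ⟨(mem_labels.1 hi).choose⟩
  choose! u hu a b hab ha hb using h2
  rw [← card_powersetCard]
  refine card_le_card_of_injOn (fun i => {a i, b i}) ?_ ?_
  · intro i hi
    refine mem_coe.2 (mem_powersetCard.2 ⟨?_, card_pair (hab i hi).ne⟩)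
    simp only [insert_subset_iff, singleton_subset_iff]
    exact ⟨ha i hi, hb i hi⟩
  · intro i hi j hj hij
    have hij' : ({a i, b i} : Finset V) = {a j, b j} := hij
    have hZS : Z ⊆ X.S := filter_subset _ _
    have hsub : ∀ x ∈ ({a i, b i} : Finset V), x ∈ X.missing (u j) := by
      rw [hij']
      intro x hx
      simp only [mem_insert, mem_singleton] at hx
      rcases hx with rfl | rfl
      · exact left_mem_missing (hab j hj) (hZS (ha j hj))
      · exact left_mem_missing (hab j hj).symm (hZS (hb j hj))
    have := eq_of_criticalPair_of_missing (hab i hi) (hsub (a i) (by simp)) (hsub (b i) (by simp))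
    rw [← hu i hi, ← hu j hj, this]

lemma card_le_label_sub_two_of_outer {u a b : V} (h : CriticalPair G u a b) (ha : a ∈ X.S)
    (hb : b ∉ X.S) : #X.labels ≤ #(X.touched a) + 2 := by
  have h1 := (card_le_card (deficient_subset_of_criticalPair h ha hb)).trans card_le_two
  have := card_labels_le (X := X) a
  omega

lemma card_label_le_of_outer_mem {u a b : V} (h : CriticalPair G u a b) (ha : a ∈ X.S)
    (hb : b ∉ X.S) (hu : u ∈ X.S) : #X.labels ≤ #(X.touched a) + 1 := by
  have h1 := (card_le_card (deficient_subset_of_criticalPair_mem h ha hb hu)).trans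
    (card_singleton _).le
  have := card_labels_le (X := X) a
  omega

/-- The centre of an outer pair would touch all but two labels, hence at least `r` of them. -/
lemma inner_of_star_free {r : ℕ} (hG : IsStarFree r G)
    (hD : ∀ v, ∃ a b, CriticalPair G v a b) (hk4 : 4 ≤ #X.labels) (hk : r + 2 ≤ #X.labels)
    (u : V) : X.Inner u := by
  rcases outer_or_inner hD hk4 u with ⟨a, b, h, ha, hb⟩ | h
  · have h1 := card_le_label_sub_two_of_outer h ha hb
    have h2 := X.card_touched_lt hG a
    omega
  · exact h

/-- For `u` in `S` the exception `u` spoils no label, so an outer centre misses only one label and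
`r + 1` labels suffice. -/
lemma inner_of_star_free_of_mem {r : ℕ} (hG : IsStarFree r G)
    (hD : ∀ v, ∃ a b, CriticalPair G v a b) (hk4 : 4 ≤ #X.labels) (hk : r + 1 ≤ #X.labels)
    {u : V} (hu : u ∈ X.S) : X.Inner u := by
  rcases outer_or_inner hD hk4 u with ⟨a, b, h, ha, hb⟩ | h
  · have h1 := card_label_le_of_outer_mem h ha hb hu
    have h2 := X.card_touched_lt hG a
    omega
  · exact h

/-- If every vertex has a critical pair in `S` then `S` is large. -/
lemma six_le_card_of_inner (h : ∀ u, X.Inner u) (hk : #X.S + 2 ≤ #X.labels) : 6 ≤ #X.S := by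
  have h1 := card_le_choose_of_inner (X := X) univ fun u _ => h u
  have h2 := X.card_add_card_compl
  have h3 := X.card_labels_le_card_compl
  rw [card_univ] at h1
  by_contra! hs
  have h4 : (#X.S).choose 2 < 2 * #X.S + 2 := by
    interval_cases #X.S <;> decide
  omega

end LabelledCut

namespace LabelledCut

variable {V κ : Type*} [Fintype V] {G : SimpleGraph V} {X : LabelledCut G κ}

/-! ### Separating sets with at most two vertices -/

/-- With no cut vertices a pair dominates at most two labels, so deleting any single vertex must
destroy a label. -/
lemma label_injective_of_empty (hD : ∀ v, ∃ a b, CriticalPair G v a b) (hS : X.S = ∅)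
    (hk : 3 ≤ #X.labels) : Function.Injective X.label ∧ #X.labels = 3 := by
  have hmem : ∀ v, v ∉ X.S := by simp [hS]
  have key : ∀ v, ∃ i j, (∀ w, w ≠ v → X.label w = i ∨ X.label w = j) := by
    intro v
    obtain ⟨a, b, h⟩ := hD v
    refine ⟨X.label a, X.label b, fun w hw => ?_⟩
    rcases h.dominates w hw with rfl | rfl | h1 | h1
    · exact Or.inl rfl
    · exact Or.inr rfl
    · exact Or.inl (X.label_eq (hmem _) (hmem _) h1.symm)
    · exact Or.inr (X.label_eq (hmem _) (hmem _) h1.symm)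
  constructor
  · intro w v hwv
    by_contra hne
    obtain ⟨i, j, h⟩ := key v
    have hsub : X.labels ⊆ {i, j} := by
      intro l hl
      obtain ⟨x, -, rfl⟩ := mem_labels.1 hl
      simp only [mem_insert, mem_singleton]
      by_cases hx : x = v
      · subst hx
        rw [← hwv]
        exact h w hne
      · exact h x hx
    have := (card_le_card hsub).trans card_le_two
    omega
  · obtain ⟨l, hl⟩ := card_pos.1 (by omega : 0 < #X.labels)
    obtain ⟨v, -, -⟩ := mem_labels.1 hl
    obtain ⟨i, j, h⟩ := key v
    have hsub : X.labels ⊆ {X.label v, i, j} := by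
      intro l hl
      obtain ⟨x, -, rfl⟩ := mem_labels.1 hl
      simp only [mem_insert, mem_singleton]
      by_cases hx : x = v
      · exact Or.inl (hx ▸ rfl)
      · exact Or.inr (h x hx)
    have := (card_le_card hsub).trans card_le_three
    omega

/-- The single vertex of label `i` is isolated, so it belongs to the critical pair of every other
vertex `w`; its partner dominates all of the second fiber except `w`, and the parity criterion
applies. -/
lemma even_card_fiber_of_singleton (hD : ∀ v, ∃ a b, CriticalPair G v a b) (hS : X.S = ∅)
    {i j : κ} (hij : i ≠ j) (hl : X.labels = {i, j}) (h1 : #(X.fiber i) = 1) :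
    Even #(X.fiber j) := by
  have hmem : ∀ v, v ∉ X.S := by simp [hS]
  obtain ⟨v, hv⟩ := card_eq_one.1 h1
  have hvi : X.label v = i := (mem_fiber.1 (hv ▸ mem_singleton_self v : v ∈ X.fiber i)).2
  have hvu : ∀ w, X.label w = i → w = v := by
    intro w hw
    have : w ∈ X.fiber i := mem_fiber.2 ⟨hmem w, hw⟩
    simpa [hv] using this
  have hother : ∀ w, w ≠ v → X.label w = j := by
    intro w hw
    have := label_mem (X := X) (hmem w)
    rw [hl, mem_insert, mem_singleton] at this
    exact this.resolve_left fun h => hw (hvu w h)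
  have hadj : ∀ w, ¬G.Adj w v := by
    intro w hw
    have := hvu w ((X.label_eq (hmem _) (hmem _) hw).trans hvi)
    exact hw.ne this
  have key : ∀ w, w ≠ v → ∀ b, CriticalPair G w v b → b ∈ X.fiber j ∧ b ≠ w ∧ ¬G.Adj b w ∧
      ∀ x ∈ X.fiber j, x ≠ w → x = b ∨ G.Adj b x := by
    intro w _ b h
    refine ⟨mem_fiber.2 ⟨hmem b, hother b h.ne.symm⟩, h.ne_right, h.not_adj_right, ?_⟩
    intro x hx hxw
    rcases h.dominates x hxw with rfl | h2 | h2 | h2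
    · exact absurd (hvi.symm.trans (mem_fiber.1 hx).2) hij
    · exact Or.inl h2
    · exact absurd h2.symm (hadj x)
    · exact Or.inr h2
  refine even_card_of_exists_unique_nonadj (G := G) _ fun w hw => ?_
  have hwv : w ≠ v := by
    rintro rfl
    exact hij (hvi.symm.trans (mem_fiber.1 hw).2)
  obtain ⟨a, b, h⟩ := hD w
  rcases h.dominates v hwv.symm with rfl | rfl | h2 | h2
  · exact ⟨b, key w hwv b h⟩
  · exact ⟨a, key w hwv a h.symm⟩
  · exact absurd h2 (hadj a)
  · exact absurd h2 (hadj b)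

lemma S_nonempty_of_even (hD : ∀ v, ∃ a b, CriticalPair G v a b)
    (hV : Even (Fintype.card V)) (hk : 2 ≤ #X.oddLabels) : X.S ≠ ∅ := by
  intro hS
  have hmem : ∀ v, v ∉ X.S := by simp [hS]
  have hle := X.card_oddLabels_le
  rcases Nat.lt_or_ge 2 #X.labels with h3 | h2
  · obtain ⟨hinj, hcard⟩ := label_injective_of_empty hD hS h3
    have h1 : #X.labels = #X.Sᶜ := card_image_of_injective _ hinj
    have h2 := X.card_add_card_compl
    rw [hS, card_empty] at h2
    rw [Nat.even_iff] at hV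
    rw [hS] at h1
    omega
  · have hl2 : #X.labels = 2 := by omega
    have hodd : ∀ i ∈ X.labels, Odd #(X.fiber i) := by
      have : X.oddLabels = X.labels := eq_of_subset_of_card_le X.oddLabels_subset (by omega)
      intro i hi
      rw [← this] at hi
      exact (mem_filter.1 hi).2
    obtain ⟨i, j, hij, hl⟩ := card_eq_two.1 hl2
    have hi : Odd #(X.fiber i) := hodd i (by simp [hl])
    have hj : Odd #(X.fiber j) := hodd j (by simp [hl])
    have hi1 : #(X.fiber i) ≠ 1 := fun h =>
      (Nat.not_even_iff_odd.2 hj) (even_card_fiber_of_singleton hD hS hij hl h)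
    have hj1 : #(X.fiber j) ≠ 1 := fun h =>
      (Nat.not_even_iff_odd.2 hi)
        (even_card_fiber_of_singleton hD hS hij.symm (by rw [hl, pair_comm]) h)
    have hex : ∀ l, 1 < #(X.fiber l) → ∀ v, ∃ w ∈ X.fiber l, w ≠ v := fun l h v =>
      exists_mem_ne h v
    have hi2 : 1 < #(X.fiber i) := by have := hi.pos; omega
    have hj2 : 1 < #(X.fiber j) := by have := hj.pos; omega
    have hdom : ∀ v a b l, CriticalPair G v a b → 1 < #(X.fiber l) →
        X.label a = l ∨ X.label b = l := by
      intro v a b l h hl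
      obtain ⟨w, hw, hwv⟩ := hex l hl v
      have hwl := (mem_fiber.1 hw).2
      rcases h.dominates w hwv with rfl | rfl | h1 | h1
      · exact Or.inl hwl
      · exact Or.inr hwl
      · exact Or.inl ((X.label_eq (hmem _) (hmem _) h1).trans hwl)
      · exact Or.inr ((X.label_eq (hmem _) (hmem _) h1).trans hwl)
    obtain ⟨v, hv⟩ := card_pos.1 (by omega : 0 < #(X.fiber i))
    have hvi := (mem_fiber.1 hv).2
    -- Here `b` dominates its whole fiber, yet the critical pair of `b` needs a vertex of that fiber
    -- not adjacent to `b`.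
    have main : ∀ a b, CriticalPair G v a b → X.label a = i → X.label b = j → False := by
      intro a b h hai hbj
      have hfull : ∀ w, X.label w = j → w = b ∨ G.Adj b w := by
        intro w hw
        rcases h.dominates w (by rintro rfl; exact hij (hvi.symm.trans hw)) with rfl | h1 | h1 | h1
        · exact absurd (hai.symm.trans hw) hij
        · exact Or.inl h1
        · exact absurd (hai.symm.trans ((X.label_eq (hmem _) (hmem _) h1).trans hw)) hij
        · exact Or.inr h1
      obtain ⟨c, d, h'⟩ := hD b
      rcases hdom b c d j h' hj2 with h1 | h1
      · rcases hfull c h1 with h2 | h2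
        · exact h'.ne_left h2
        · exact h'.not_adj_left h2.symm
      · rcases hfull d h1 with h2 | h2
        · exact h'.ne_right h2
        · exact h'.not_adj_right h2.symm
    obtain ⟨a, b, h⟩ := hD v
    rcases hdom v a b i h hi2 with h1 | h1
    · rcases hdom v a b j h hj2 with h2 | h2
      · exact hij (h1.symm.trans h2)
      · exact main a b h h1 h2
    · rcases hdom v a b j h hj2 with h2 | h2
      · exact main b a h.symm h1 h2
      · exact hij (h1.symm.trans h2)

/-- The critical pair of a vertex of `S` uses another vertex of `S`. If `#X.S = 2` this pair is
outer, so each vertex of `S` has at most one deficient label; these sets cannot cover four labels.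
-/
lemma three_le_card_S (hD : ∀ v, ∃ a b, CriticalPair G v a b) (hne : X.S ≠ ∅)
    (hk : #X.S + 2 ≤ #X.labels) : 3 ≤ #X.S := by
  have hpos := card_pos.2 (nonempty_iff_ne_empty.2 hne)
  by_contra! hlt
  have hcases : #X.S = 1 ∨ #X.S = 2 := by omega
  rcases hcases with h1 | h2
  · obtain ⟨u, hu⟩ := card_eq_one.1 h1
    have huS : u ∈ X.S := by simp [hu]
    rcases outer_or_inner_of_mem hD (by omega) huS with ⟨a, b, h, ha, -⟩ | ⟨a, b, h, ha, -⟩ <;>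
    exact h.ne_left (by simpa [hu] using ha)
  · have hm : ∀ a ∈ X.S, #(X.deficient a) ≤ 1 := by
      obtain ⟨u, v, huv, hS⟩ := card_eq_two.1 h2
      have key : ∀ x y, X.S = {x, y} → #(X.deficient y) ≤ 1 := by
        intro x y hS
        have hxS : x ∈ X.S := by simp [hS]
        rcases outer_or_inner_of_mem hD (by omega) hxS with ⟨a, b, h, ha, hb⟩ | ⟨a, b, h, ha, hb⟩
        · have := card_le_card (deficient_subset_of_criticalPair_mem h ha hb hxS)
          have hay : a = y := by
            rw [hS] at ha
            simpa [h.ne_left] using ha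
          rwa [hay, card_singleton] at this
        · rw [hS] at ha hb
          have hay : a = y := by simpa [h.ne_left] using ha
          have hby : b = y := by simpa [h.ne_right] using hb
          exact absurd (hay.trans hby.symm) h.ne
      intro a ha
      rw [hS, mem_insert, mem_singleton] at ha
      rcases ha with rfl | rfl
      · exact key v _ (by rw [hS, pair_comm])
      · exact key u _ hS
    have h3 := card_le_card (labels_subset_biUnion_deficient hD (by omega : 4 ≤ #X.labels))
    have h4 := card_biUnion_le (s := X.S) (t := X.deficient)
    have h5 := sum_le_card_nsmul X.S _ 1 hm
    simp only [smul_eq_mul, mul_one] at h5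
    omega

/-! ### Separating sets with three vertices -/

omit [Fintype V] in
lemma not_adj_of_inner (h3 : #X.S = 3) (h : ∀ v ∈ X.S, X.Inner v) {x y : V}
    (hx : x ∈ X.S) (hy : y ∈ X.S) : ¬G.Adj x y := by
  obtain ⟨a, b, hab, ha, hb⟩ := h y hy
  have hS : ({y, a, b} : Finset V) = X.S := by
    apply eq_of_subset_of_card_le
    · simp [insert_subset_iff, ha, hb, hy]
    · rw [h3, card_eq_three.2 ⟨y, a, b, hab.ne_left.symm, hab.ne_right.symm, hab.ne, rfl⟩]
  rw [← hS] at hx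
  simp only [mem_insert, mem_singleton] at hx
  rcases hx with rfl | rfl | rfl
  · exact G.irrefl
  · exact hab.not_adj_left
  · exact hab.not_adj_right

lemma outer_of_independent (hD : ∀ v, ∃ a b, CriticalPair G v a b) (hk : 4 ≤ #X.labels)
    (h3 : #X.S = 3) (hind : ∀ x ∈ X.S, ∀ y ∈ X.S, ¬G.Adj x y) {u : V} (hu : u ∉ X.S) :
    X.Outer u := by
  rcases outer_or_inner hD hk u with h | ⟨a, b, h, ha, hb⟩
  · exact h
  · exfalso
    obtain ⟨c, hc, hcab⟩ := exists_mem_notMem_of_card_lt_card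
      (lt_of_le_of_lt (card_le_two (a := a) (b := b)) (by omega : 2 < #X.S))
    simp only [mem_insert, mem_singleton, not_or] at hcab
    rcases h.dominates c (by rintro rfl; exact hu hc) with h1 | h1 | h1 | h1
    · exact hcab.1 h1
    · exact hcab.2 h1
    · exact hind _ ha _ hc h1
    · exact hind _ hb _ hc h1

lemma card_deficient_le_two_of_card_three (hD : ∀ v, ∃ a b, CriticalPair G v a b)
    (h3 : #X.S = 3) (hk : 5 ≤ #X.labels) : ∀ a ∈ X.S, #(X.deficient a) ≤ 2 := by
  have h1 := card_labels_le_sum_add_choose hD (by omega : 4 ≤ #X.labels)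
  have h2 := card_filter_add_card_filter_not (s := X.S) (fun a => #(X.deficient a) ≤ 2)
  have h4 := sum_le_card_nsmul {a ∈ X.S | #(X.deficient a) ≤ 2} (fun a => #(X.deficient a)) 2
    (fun a ha => (mem_filter.1 ha).2)
  rw [smul_eq_mul] at h4
  -- With `z` large deficient sets the bound on labels is `2 * (3 - z) + z.choose 2`, which reaches
  -- 5 only for `z = 0`.
  have h5 : #{a ∈ X.S | ¬#(X.deficient a) ≤ 2} = 0 := by
    generalize #{a ∈ X.S | ¬#(X.deficient a) ≤ 2} = z at *
    have hz : z ≤ 3 := by omega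
    interval_cases z <;> simp [Nat.choose] at h1 <;> omega
  intro a ha
  by_contra h
  rw [card_eq_zero] at h5
  have : a ∈ ({a ∈ X.S | ¬#(X.deficient a) ≤ 2} : Finset V) := mem_filter.2 ⟨ha, h⟩
  rw [h5] at this
  simp at this

/-- The outer pair of a vertex labelled `j` is centred at `x` with partner `b` labelled `i`, and
independence of `S` makes `b` dominate `y`. The outer pair of `b` is then again centred at `x`, with
partner outside label `i`, so `x` must dominate the fiber except `b`. -/
lemma exists_near_private_vertex {x y z : V} (hS : X.S = {x, y, z}) (hxy : x ≠ y)
    (hind : ∀ x ∈ X.S, ∀ y ∈ X.S, ¬G.Adj x y) (hout : ∀ u, u ∉ X.S → X.Outer u) {i j : κ}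
    (hij : j ≠ i) (hx : X.deficient x = {i, j}) (hjy : j ∉ X.deficient y)
    (hjz : j ∉ X.deficient z) (hiz : i ∉ X.deficient z) :
    ∃ b ∈ X.fiber i, ¬G.Adj x b ∧ G.Adj b y ∧ ∀ t ∈ X.fiber i, t ≠ b → G.Adj x t := by
  have hxS : x ∈ X.S := by simp [hS]
  have hyS : y ∈ X.S := by simp [hS]
  obtain ⟨w, hw, rfl, -⟩ := mem_deficient.1 (by rw [hx]; simp : j ∈ X.deficient x)
  obtain ⟨a, b, h, ha, hb⟩ := hout w hw
  have hax : a = x := by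
    have h1 := label_mem_deficient hw h.not_adj_left
    rw [hS, mem_insert, mem_insert, mem_singleton] at ha
    rcases ha with rfl | rfl | rfl
    · rfl
    · exact absurd h1 hjy
    · exact absurd h1 hjz
  subst hax
  have hbi : X.label b = i := by
    have h1 := deficient_subset_of_criticalPair h ha hb
    have h2 : i ∈ ({X.label w, X.label b} : Finset κ) := h1 (by rw [hx]; simp)
    simp only [mem_insert, mem_singleton] at h2
    exact (h2.resolve_left fun h => hij h.symm).symm
  have hby : G.Adj b y := by
    rcases h.dominates y (by rintro rfl; exact hw hyS) with h1 | h1 | h1 | h1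
    · exact absurd h1.symm hxy
    · exact absurd hyS (h1 ▸ hb)
    · exact absurd h1 (hind _ hxS _ hyS)
    · exact h1
  obtain ⟨a', c, h', ha', hc⟩ := hout b hb
  have hax' : a' = a := by
    rw [hS, mem_insert, mem_insert, mem_singleton] at ha'
    rcases ha' with rfl | rfl | rfl
    · rfl
    · exact absurd hby.symm h'.not_adj_left
    · exact absurd (hbi ▸ label_mem_deficient hb h'.not_adj_left) hiz
  subst hax'
  have hcl : X.label c ≠ i := by
    intro hci
    have h1 := deficient_subset_of_criticalPair h' ha' hc
    have h2 : X.label w ∈ ({X.label b, X.label c} : Finset κ) := h1 (by rw [hx]; simp)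
    rw [hbi, hci] at h2
    simp [hij] at h2
  refine ⟨b, mem_fiber.2 ⟨hb, hbi⟩, h'.not_adj_left, hby, fun t ht htb => ?_⟩
  rw [mem_fiber] at ht
  exact adj_of_criticalPair h' ha' hc ht.1 htb (by rw [ht.2]; exact hcl.symm)

lemma exists_eq_pair_of_card_eq_two {α : Type*} {T : Finset α} {i : α} (h : #T = 2)
    (hi : i ∈ T) : ∃ j, j ≠ i ∧ T = {i, j} := by
  obtain ⟨a, b, hab, rfl⟩ := card_eq_two.1 h
  simp only [mem_insert, mem_singleton] at hi
  rcases hi with rfl | rfl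
  · exact ⟨b, hab.symm, rfl⟩
  · exact ⟨a, hab, pair_comm _ _⟩

/-- Three 2-sets covering five labels overlap only once, so `z` is joined to the whole fiber of `i`,
while `x` and `y` each miss one vertex of it. Every vertex has a non-neighbour in `S`, so the fiber
consists of these two vertices. -/
lemma even_card_fiber_of_mem_deficient_of_mem_deficient
    (hD : ∀ v, ∃ a b, CriticalPair G v a b) (hk : #X.labels = 5) {x y z : V}
    (hS : X.S = {x, y, z}) (h3 : #X.S = 3) (hm : ∀ a ∈ X.S, #(X.deficient a) = 2) {i : κ}
    (hix : i ∈ X.deficient x) (hiy : i ∈ X.deficient y) : Even #(X.fiber i) := by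
  have hxS : x ∈ X.S := by simp [hS]
  have hyS : y ∈ X.S := by simp [hS]
  have hzS : z ∈ X.S := by simp [hS]
  have hxy : x ≠ y := by
    rintro rfl
    rw [hS] at h3
    have := card_le_two (a := x) (b := z)
    simp only [insert_eq_of_mem, mem_insert_self] at h3
    omega
  have hinner : ∀ v ∈ X.S, X.Inner v := by
    intro v hv
    rcases outer_or_inner (X := X) hD (by omega) v with ⟨a, b, h, ha, hb⟩ | h
    · have := card_le_card (deficient_subset_of_criticalPair_mem h ha hb hv)
      rw [hm a ha, card_singleton] at this
      omega
    · exact h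
  have hind : ∀ x ∈ X.S, ∀ y ∈ X.S, ¬G.Adj x y := fun x hx y hy =>
    not_adj_of_inner h3 hinner hx hy
  have hout : ∀ u, u ∉ X.S → X.Outer u := fun u hu =>
    outer_of_independent (X := X) hD (by omega) h3 hind hu
  obtain ⟨j, hji, hxe⟩ := exists_eq_pair_of_card_eq_two (hm x hxS) hix
  obtain ⟨l, hli, hye⟩ := exists_eq_pair_of_card_eq_two (hm y hyS) hiy
  have hsub : X.labels ⊆ X.deficient z ∪ {i, j, l} := by
    refine (labels_subset_biUnion_deficient hD (by omega)).trans ?_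
    intro t ht
    simp only [hS, mem_biUnion, mem_insert, mem_singleton, exists_eq_or_imp, exists_eq_left,
      hxe, hye] at ht
    simp only [mem_union, mem_insert, mem_singleton]
    tauto
  have hsmall : ∀ T : Finset κ, #T ≤ 2 → ¬X.labels ⊆ X.deficient z ∪ T := by
    intro T hT h
    have h1 := (card_le_card h).trans (card_union_le _ _)
    rw [hm z hzS] at h1
    omega
  have hiz : i ∉ X.deficient z := by
    intro h
    refine hsmall {j, l} card_le_two (hsub.trans ?_)
    intro t
    grind
  have hjz : j ∉ X.deficient z := by
    intro h
    refine hsmall {i, l} card_le_two (hsub.trans ?_)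
    intro t
    grind
  have hlz : l ∉ X.deficient z := by
    intro h
    refine hsmall {i, j} card_le_two (hsub.trans ?_)
    intro t
    grind
  have hjl : j ≠ l := by
    rintro rfl
    refine hsmall {i, j} card_le_two (hsub.trans ?_)
    intro t
    grind
  obtain ⟨b, hb, hxb, hby, hbx⟩ := exists_near_private_vertex hS hxy hind hout
    hji hxe (by rw [hye]; simp [hji, hjl]) hjz hiz
  obtain ⟨c, hc, hyc, hcx, hcy⟩ := exists_near_private_vertex
    (x := y) (y := x) (z := z) (by rw [hS, insert_comm]) hxy.symm hind hout
    hli hye (by rw [hxe]; simp [hli, hjl.symm]) hlz hiz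
  have hbc : b ≠ c := by
    rintro rfl
    exact hxb hcx.symm
  have hfib : X.fiber i = {b, c} := by
    ext t
    simp only [mem_insert, mem_singleton]
    constructor
    · intro ht
      by_contra! hne
      have h1 := hbx t ht hne.1
      have h2 := hcy t ht hne.2
      rw [mem_fiber] at ht
      have h4 : G.Adj z t := adj_of_notMem_deficient ht.1 (by rwa [ht.2])
      obtain ⟨a, ha⟩ := missing_nonempty hD (by omega : 4 ≤ #X.labels) t
      rw [mem_missing, hS] at ha
      obtain ⟨h5, -, h6⟩ := ha
      simp only [mem_insert, mem_singleton] at h5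
      rcases h5 with rfl | rfl | rfl <;> contradiction
    · rintro (rfl | rfl) <;> assumption
  rw [hfib, card_pair hbc]
  exact even_two

/-- The deficient sets must have sizes 2, 2, 1 and partition the labels. The fiber of the lone label
`i` is joined to `x` and `y`, hence not at all to `z`; outer pairs of its vertices are centred at
`z` with partners in the same fiber, which pairs up its vertices. -/
lemma exists_even_fiber_of_card_deficient_le_one
    (hD : ∀ v, ∃ a b, CriticalPair G v a b) (hk : #X.labels = 5) {x y z : V}
    (hS : X.S = {x, y, z}) (h3 : #X.S = 3) (hm : ∀ a ∈ X.S, #(X.deficient a) ≤ 2)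
    (hz : #(X.deficient z) ≤ 1) : ∃ i ∈ X.labels, Even #(X.fiber i) := by
  have hxS : x ∈ X.S := by simp [hS]
  have hyS : y ∈ X.S := by simp [hS]
  have hzS : z ∈ X.S := by simp [hS]
  have hxz : x ≠ z ∧ y ≠ z := by
    have h := h3
    rw [hS] at h
    constructor <;> rintro rfl
    · rw [insert_eq_of_mem (by simp)] at h
      have := card_le_two (a := y) (b := x)
      omega
    · rw [pair_eq_singleton] at h
      have := card_le_two (a := x) (b := y)
      omega
  have hsub : X.labels ⊆ X.deficient x ∪ X.deficient y ∪ X.deficient z := by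
    refine (labels_subset_biUnion_deficient hD (by omega)).trans ?_
    intro t ht
    simp only [hS, mem_biUnion, mem_insert, mem_singleton, exists_eq_or_imp, exists_eq_left] at ht
    simp only [mem_union]
    tauto
  have hmx := hm x hxS
  have hmy := hm y hyS
  have hc1 := card_le_card hsub
  have hc2 := card_union_le (X.deficient x ∪ X.deficient y) (X.deficient z)
  have hc3 := card_union_le (X.deficient x) (X.deficient y)
  have hz1 : #(X.deficient z) = 1 := by omega
  obtain ⟨i, hi⟩ := card_eq_one.1 hz1
  have hdisj : i ∉ X.deficient x ∪ X.deficient y := by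
    intro h
    have h1 : X.labels ⊆ X.deficient x ∪ X.deficient y := by
      refine hsub.trans (union_subset (Subset.refl _) ?_)
      rw [hi]
      simpa using h
    have := card_le_card h1
    omega
  simp only [mem_union, not_or] at hdisj
  have hx2 : #(X.deficient x) = 2 ∧ #(X.deficient y) = 2 := by omega
  have hfull : ∀ b, b ∉ X.S → X.label b = i → G.Adj x b ∧ G.Adj y b := fun b hb hbi =>
    ⟨adj_of_notMem_deficient hb (hbi ▸ hdisj.1), adj_of_notMem_deficient hb (hbi ▸ hdisj.2)⟩
  have hinner : ∀ v ∈ X.S, X.Inner v := by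
    intro v hv
    rcases outer_or_inner (X := X) hD (by omega) v with ⟨a, b, h, ha, hb⟩ | h
    · exfalso
      have h1 := deficient_subset_of_criticalPair_mem h ha hb hv
      have h2 := card_le_card h1
      rw [card_singleton] at h2
      have haz : a = z := by
        rw [hS, mem_insert, mem_insert, mem_singleton] at ha
        rcases ha with rfl | rfl | rfl
        · omega
        · omega
        · rfl
      subst haz
      have hbi : X.label b = i := by
        rw [hi, singleton_subset_iff, mem_singleton] at h1
        exact h1.symm
      have h4 := hfull b hb hbi
      rw [hS, mem_insert, mem_insert, mem_singleton] at hv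
      rcases hv with rfl | rfl | rfl
      · exact h.not_adj_right h4.1.symm
      · exact h.not_adj_right h4.2.symm
      · exact h.ne_left rfl
    · exact h
  have hind : ∀ x ∈ X.S, ∀ y ∈ X.S, ¬G.Adj x y := fun x hx y hy =>
    not_adj_of_inner h3 hinner hx hy
  have hnz : ∀ t, t ∉ X.S → G.Adj x t → G.Adj y t → ¬G.Adj z t := by
    intro t _ h1 h2 h4
    obtain ⟨a, ha⟩ := missing_nonempty hD (by omega : 4 ≤ #X.labels) t
    rw [mem_missing, hS] at ha
    obtain ⟨h5, -, h6⟩ := ha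
    simp only [mem_insert, mem_singleton] at h5
    rcases h5 with rfl | rfl | rfl <;> contradiction
  refine ⟨i, deficient_subset_labels z (by simp [hi]), ?_⟩
  refine even_card_of_exists_unique_nonadj (G := G) _ fun w hw => ?_
  rw [mem_fiber] at hw
  obtain ⟨hwx, hwy⟩ := hfull w hw.1 hw.2
  obtain ⟨a, b, h, ha, hb⟩ := outer_of_independent (X := X) hD (by omega) h3 hind hw.1
  have haz : a = z := by
    rw [hS, mem_insert, mem_insert, mem_singleton] at ha
    rcases ha with rfl | rfl | rfl
    · exact absurd hwx h.not_adj_left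
    · exact absurd hwy h.not_adj_left
    · rfl
  subst haz
  have hbadj : ∀ v ∈ X.S, v ≠ a → G.Adj v b := by
    intro v hv hva
    rcases h.dominates v (by rintro rfl; exact hw.1 hv) with h1 | h1 | h1 | h1
    · exact absurd h1 hva
    · exact absurd hv (h1 ▸ hb)
    · exact absurd h1 (hind _ ha _ hv)
    · exact h1.symm
  have hbi : X.label b = i := by
    have h1 := label_mem_deficient hb (hnz b hb (hbadj x hxS hxz.1) (hbadj y hyS hxz.2))
    rw [hi] at h1
    simpa using h1
  refine ⟨b, mem_fiber.2 ⟨hb, hbi⟩, h.ne_right, h.not_adj_right, fun t ht htw => ?_⟩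
  rw [mem_fiber] at ht
  rcases h.dominates t htw with rfl | h1 | h1 | h1
  · exact absurd hzS ht.1
  · exact Or.inl h1
  · exact absurd h1 (hnz t ht.1 (hfull t ht.1 ht.2).1 (hfull t ht.1 ht.2).2)
  · exact Or.inr h1

lemma exists_even_fiber_of_card_three (hD : ∀ v, ∃ a b, CriticalPair G v a b)
    (h3 : #X.S = 3) (hk : #X.labels = 5) : ∃ i ∈ X.labels, Even #(X.fiber i) := by
  have hm := card_deficient_le_two_of_card_three hD h3 hk.ge
  obtain ⟨x, y, z, hxy, hxz, hyz, hS⟩ := card_eq_three.1 h3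
  have hxS : x ∈ X.S := by simp [hS]
  have hyS : y ∈ X.S := by simp [hS]
  have hzS : z ∈ X.S := by simp [hS]
  by_cases hm2 : ∀ a ∈ X.S, #(X.deficient a) = 2
  · have hsub : X.labels ⊆ X.deficient x ∪ X.deficient y ∪ X.deficient z := by
      refine (labels_subset_biUnion_deficient hD (by omega)).trans ?_
      intro t ht
      simp only [hS, mem_biUnion, mem_insert, mem_singleton, exists_eq_or_imp,
        exists_eq_left] at ht
      simp only [mem_union]
      tauto
    by_cases h1 : Disjoint (X.deficient x) (X.deficient y)
    · by_cases h2 : Disjoint (X.deficient x ∪ X.deficient y) (X.deficient z)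
      · have h4 := card_union_of_disjoint h2
        rw [card_union_of_disjoint h1, hm2 x hxS, hm2 y hyS, hm2 z hzS] at h4
        have h5 : X.deficient x ∪ X.deficient y ∪ X.deficient z ⊆ X.labels :=
          union_subset (union_subset (deficient_subset_labels x) (deficient_subset_labels y))
            (deficient_subset_labels z)
        have := card_le_card h5
        omega
      · rw [not_disjoint_iff] at h2
        obtain ⟨i, hi, hiz⟩ := h2
        refine ⟨i, deficient_subset_labels z hiz, ?_⟩
        rcases mem_union.1 hi with hi | hi
        · exact even_card_fiber_of_mem_deficient_of_mem_deficient hD hk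
            (x := x) (y := z) (z := y) (by rw [hS, pair_comm]) h3 hm2 hi hiz
        · exact even_card_fiber_of_mem_deficient_of_mem_deficient hD hk
            (x := y) (y := z) (z := x) (by rw [hS, insert_comm, pair_comm x z]) h3 hm2 hi hiz
    · rw [not_disjoint_iff] at h1
      obtain ⟨i, hix, hiy⟩ := h1
      exact ⟨i, deficient_subset_labels x hix,
        even_card_fiber_of_mem_deficient_of_mem_deficient hD hk hS h3 hm2 hix hiy⟩
  · push Not at hm2
    obtain ⟨a, ha, ha2⟩ := hm2
    have ha1 : #(X.deficient a) ≤ 1 := by have := hm a ha; omega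
    rw [hS, mem_insert, mem_insert, mem_singleton] at ha
    rcases ha with rfl | rfl | rfl
    · exact exists_even_fiber_of_card_deficient_le_one hD hk (x := y) (y := z)
        (by rw [hS, insert_comm, pair_comm]) h3 hm ha1
    · exact exists_even_fiber_of_card_deficient_le_one hD hk (x := x) (y := z)
        (by rw [hS, pair_comm]) h3 hm ha1
    · exact exists_even_fiber_of_card_deficient_le_one hD hk hS h3 hm ha1

/-- Three sets of size at most two can cover six labels only by partitioning them. -/
lemma disjoint_deficient_of_six_le (hD : ∀ v, ∃ a b, CriticalPair G v a b)
    (h3 : #X.S = 3) (hk : 6 ≤ #X.labels) {a b : V} (ha : a ∈ X.S) (hb : b ∈ X.S) (hab : a ≠ b) :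
    #(X.deficient a) = 2 ∧ Disjoint (X.deficient a) (X.deficient b) ∧ #X.labels = 6 := by
  have hm := card_deficient_le_two_of_card_three hD h3 (by omega)
  obtain ⟨c, hc, hcab⟩ := exists_mem_notMem_of_card_lt_card
    (lt_of_le_of_lt (card_le_two (a := a) (b := b)) (by omega : 2 < #X.S))
  simp only [mem_insert, mem_singleton, not_or] at hcab
  have hS : ({a, b, c} : Finset V) = X.S := by
    apply eq_of_subset_of_card_le
    · simp [insert_subset_iff, ha, hb, hc]
    · rw [h3, card_eq_three.2 ⟨a, b, c, hab, Ne.symm hcab.1, Ne.symm hcab.2, rfl⟩]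
  have hsub := labels_subset_biUnion_deficient (X := X) hD (by omega)
  rw [← hS, biUnion_insert, biUnion_insert, singleton_biUnion] at hsub
  have h1 := card_le_card hsub
  have h2 := card_union_le (X.deficient a) (X.deficient b ∪ X.deficient c)
  have h4 := card_union_le (X.deficient b) (X.deficient c)
  have h5 := card_union_add_card_inter (X.deficient a) (X.deficient b ∪ X.deficient c)
  have ha2 := hm a ha
  have hb2 := hm b hb
  have hc2 := hm c hc
  refine ⟨by omega, ?_, by omega⟩
  have h6 : #(X.deficient a ∩ (X.deficient b ∪ X.deficient c)) = 0 := by omega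
  rw [card_eq_zero, ← disjoint_iff_inter_eq_empty] at h6
  exact h6.mono_right subset_union_left

/-- The deficient sets are three disjoint pairs of labels, so a vertex outside `S` has exactly one
non-neighbour in `S`. Outer pairs show that every fiber is a single vertex, and the adjacency is
then determined. -/
lemma nonempty_iso_exceptional9 (hD : ∀ v, ∃ a b, CriticalPair G v a b)
    (h3 : #X.S = 3) (hk : 6 ≤ #X.labels) : Nonempty (G ≃g exceptional9) := by
  have hdisj : ∀ {a b i}, a ∈ X.S → b ∈ X.S → i ∈ X.deficient a → i ∈ X.deficient b → a = b := by
    intro a b i ha hb hia hib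
    by_contra hab
    exact disjoint_left.1 (disjoint_deficient_of_six_le hD h3 hk ha hb hab).2.1 hia hib
  have hm2 : ∀ a ∈ X.S, #(X.deficient a) = 2 ∧ #X.labels = 6 := by
    intro a ha
    obtain ⟨b, hb, hba⟩ := exists_mem_ne (by omega : 1 < #X.S) a
    have h := disjoint_deficient_of_six_le hD h3 hk ha hb hba.symm
    exact ⟨h.1, h.2.2⟩
  have hk6 : #X.labels = 6 := by
    obtain ⟨a, ha⟩ := card_pos.1 (by omega : 0 < #X.S)
    exact (hm2 a ha).2
  have hind : ∀ x ∈ X.S, ∀ y ∈ X.S, ¬G.Adj x y := fun x hx y hy =>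
    not_adj_of_inner h3 (fun v hv => by
      rcases outer_or_inner (X := X) hD (by omega) v with ⟨a, b, h, ha, hb⟩ | h
      · have := card_le_card (deficient_subset_of_criticalPair_mem h ha hb hv)
        rw [(hm2 a ha).1, card_singleton] at this
        omega
      · exact h) hx hy
  have huni : ∀ {u a b}, u ∉ X.S → a ∈ X.S → b ∈ X.S → ¬G.Adj a u → ¬G.Adj b u → a = b :=
    fun hu ha hb h1 h2 => hdisj ha hb (label_mem_deficient hu h1) (label_mem_deficient hu h2)
  have hex : ∀ u, ∃ a ∈ X.S, ¬G.Adj a u := by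
    intro u
    obtain ⟨a, ha⟩ := missing_nonempty hD (by omega : 4 ≤ #X.labels) u
    rw [mem_missing] at ha
    exact ⟨a, ha.1, ha.2.2⟩
  -- The centre `a` for `u` is adjacent to any other `t` of that label, but `a` is also the only
  -- vertex of `S` that `t` could miss.
  have hinj : ∀ {u t}, u ∉ X.S → t ∉ X.S → X.label t = X.label u → t = u := by
    intro u t hu ht htu
    by_contra hne
    obtain ⟨a, b, h, ha, hb⟩ := outer_of_independent (X := X) hD (by omega) h3 hind hu
    have hlb : X.label u ≠ X.label b := by
      intro h1
      have h2 := card_le_card (deficient_subset_of_criticalPair h ha hb)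
      rw [(hm2 a ha).1, h1, pair_eq_singleton, card_singleton] at h2
      omega
    have hat := adj_of_criticalPair h ha hb ht hne (by rw [htu]; exact hlb)
    obtain ⟨c, hc, hct⟩ := hex t
    have hca : c = a := hdisj hc ha (label_mem_deficient ht hct)
      (by rw [htu]; exact label_mem_deficient hu h.not_adj_left)
    exact hct (hca ▸ hat)
  have hcard : Fintype.card V = 9 := by
    have h1 : #X.labels = #X.Sᶜ := card_image_of_injOn fun u hu t ht h =>
      (hinj (by simpa using ht) (by simpa using hu) h)
    have := X.card_add_card_compl
    omega
  let e : Fin 3 ≃ X.S := (X.S.equivFinOfCardEq h3).symm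
  let M : V → Finset V := fun a => {u | u ∉ X.S ∧ ¬G.Adj a u}
  have hMmem : ∀ a u, u ∈ M a ↔ u ∉ X.S ∧ ¬G.Adj a u := by simp [M]
  have hM : ∀ a ∈ X.S, #(M a) = 2 := by
    intro a ha
    rw [← (hm2 a ha).1]
    refine card_bij (fun u _ => X.label u) ?_ ?_ ?_
    · intro u hu
      rw [hMmem] at hu
      exact label_mem_deficient hu.1 hu.2
    · intro u hu t ht h
      rw [hMmem] at hu ht
      exact hinj ht.1 hu.1 h
    · intro i hi
      obtain ⟨w, hw, rfl, haw⟩ := mem_deficient.1 hi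
      exact ⟨w, (hMmem _ _).2 ⟨hw, haw⟩, rfl⟩
  let f : ∀ i : Fin 3, Fin 2 ≃ M (e i) := fun i =>
    ((M (e i)).equivFinOfCardEq (hM _ (e i).2)).symm
  have hf : ∀ i t, (f i t : V) ∉ X.S ∧ ¬G.Adj (e i) (f i t) := fun i t =>
    (hMmem _ _).1 (f i t).2
  let φ : Fin 3 ⊕ Fin 3 × Fin 2 → V := Sum.elim (fun i => (e i : V)) (fun q => (f q.1 q.2 : V))
  have hφ : Function.Injective φ := by
    rintro (i | ⟨i, t⟩) (j | ⟨j, t'⟩) h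
    · simp only [φ, Sum.elim_inl] at h
      rw [e.injective (Subtype.ext h)]
    · simp only [φ, Sum.elim_inl, Sum.elim_inr] at h
      exact absurd (h ▸ (e i).2) (hf j t').1
    · simp only [φ, Sum.elim_inl, Sum.elim_inr] at h
      exact absurd (h ▸ (e j).2) (hf i t).1
    · simp only [φ, Sum.elim_inr] at h
      obtain rfl : i = j := by
        apply e.injective
        apply Subtype.ext
        refine huni (hf i t).1 (e i).2 (e j).2 (hf i t).2 ?_
        rw [h]
        exact (hf j t').2
      rw [(f i).injective (Subtype.ext h)]
  have hbij : Function.Bijective φ := by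
    rw [Fintype.bijective_iff_injective_and_card]
    exact ⟨hφ, by simp [hcard]⟩
  have hsf : ∀ i j t, G.Adj (e i) (f j t) ↔ i ≠ j := by
    intro i j t
    constructor
    · rintro h rfl
      exact (hf i t).2 h
    · intro hij
      by_contra h
      exact hij (e.injective (Subtype.ext (huni (hf j t).1 (e i).2 (e j).2 h (hf j t).2)))
  refine ⟨SimpleGraph.Iso.symm ⟨Equiv.ofBijective φ hbij, ?_⟩⟩
  rintro (i | ⟨i, t⟩) (j | ⟨j, t'⟩)
  · change G.Adj (e i) (e j) ↔ False
    exact iff_false_intro (hind _ (e i).2 _ (e j).2)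
  · exact hsf i j t'
  · change G.Adj (f i t) (e j) ↔ j ≠ i
    rw [G.adj_comm]
    exact hsf j i t
  · change G.Adj (f i t) (f j t') ↔ False
    refine iff_false_intro fun h => ?_
    have := hinj (hf j t').1 (hf i t).1 (X.label_eq (hf i t).1 (hf j t').1 h)
    rw [this] at h
    exact G.irrefl h

/-! ### Separating sets with four vertices -/

/-- If all pairs were inner, with `{a, b}` for `v` and `a` adjacent to the fourth vertex `c`, then
`c` would have the pair `{v, b}`. Hence `b` is adjacent to `a`, which leaves only `v` for the pair
of `a`. -/
lemma exists_outer_of_card_four (hD : ∀ v, ∃ a b, CriticalPair G v a b)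
    (h4 : #X.S = 4) (hk : 4 ≤ #X.labels) : ∃ v ∈ X.S, X.Outer v := by
  by_contra! hcon
  have hin : ∀ v ∈ X.S, X.Inner v := fun v hv =>
    (outer_or_inner hD hk v).resolve_left (hcon v hv)
  have main : ∀ v a b c, X.S = {v, a, b, c} → CriticalPair G v a b → v ≠ c → a ≠ c → b ≠ c →
      G.Adj a c → False := by
    intro v a b c hS h hvc hac hbc hadj
    have hmem : ∀ x ∈ X.S, x = v ∨ x = a ∨ x = b ∨ x = c := by simp [hS]
    have hna : ∀ x ∈ X.S, ∀ p q, CriticalPair G x p q → p ∈ X.S → q ∈ X.S →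
        ∀ y z, (∀ w ∈ X.S, w = x ∨ w = y ∨ w = z ∨ G.Adj w x) →
        (p = y ∧ q = z) ∨ (p = z ∧ q = y) := by
      intro x _ p q hpq hp hq y z hw
      have h1 := hw p hp
      have h2 := hw q hq
      have h3 := hpq.ne
      have := hpq.ne_left
      have := hpq.ne_right
      have := hpq.not_adj_left
      have := hpq.not_adj_right
      rcases h1 with h1 | h1 | h1 | h1 <;> rcases h2 with h2 | h2 | h2 | h2 <;>
        first | contradiction | (subst h1; subst h2; simp_all)
    have hcS : c ∈ X.S := by simp [hS]
    have haS : a ∈ X.S := by simp [hS]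
    have hvS : v ∈ X.S := by simp [hS]
    have hbS : b ∈ X.S := by simp [hS]
    obtain ⟨p, q, hpq, hp, hq⟩ := hin c hcS
    have hc : ∀ x, x ≠ c → x = v ∨ x = b ∨ G.Adj v x ∨ G.Adj b x := by
      intro x hx
      have h2 := hpq.dominates x hx
      rcases hna c hcS p q hpq hp hq v b (fun w hw => by
        rcases hmem w hw with rfl | rfl | rfl | rfl <;> simp [hadj]) with ⟨rfl, rfl⟩ | ⟨rfl, rfl⟩ <;>
      tauto
    have hab : G.Adj b a := by
      rcases hc a hac with h1 | h1 | h1 | h1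
      · exact absurd h1 h.ne_left
      · exact absurd h1 h.ne
      · exact absurd h1.symm h.not_adj_left
      · exact h1
    obtain ⟨p', q', hpq', hp', hq'⟩ := hin a haS
    -- Both candidate slots are `v`, the only non-neighbour of `a` in `S`, contradicting
    -- distinctness.
    rcases hna a haS p' q' hpq' hp' hq' v v (fun w hw => by
      rcases hmem w hw with rfl | rfl | rfl | rfl <;> simp [hadj.symm, hab]) with
      ⟨rfl, h5⟩ | ⟨rfl, h5⟩ <;> exact hpq'.ne h5.symm
  obtain ⟨v, hv⟩ := card_pos.1 (by omega : 0 < #X.S)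
  obtain ⟨a, b, h, ha, hb⟩ := hin v hv
  obtain ⟨c, hc, hcn⟩ := exists_mem_notMem_of_card_lt_card
    (lt_of_le_of_lt (card_le_three (a := v) (b := a) (c := b)) (by omega : 3 < #X.S))
  simp only [mem_insert, mem_singleton, not_or] at hcn
  have hS : X.S = {v, a, b, c} := by
    symm
    apply eq_of_subset_of_card_le
    · simp [insert_subset_iff, ha, hb, hc, hv]
    · rw [h4, card_insert_of_notMem, card_eq_three.2 ⟨a, b, c, h.ne, Ne.symm hcn.2.1,
        Ne.symm hcn.2.2, rfl⟩]
      simp [h.ne_left.symm, h.ne_right.symm, Ne.symm hcn.1]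
  rcases h.dominates c hcn.1 with h1 | h1 | h1 | h1
  · exact hcn.2.1 h1
  · exact hcn.2.2 h1
  · exact main v a b c hS h (Ne.symm hcn.1) (Ne.symm hcn.2.1) (Ne.symm hcn.2.2) h1
  · exact main v b a c (by rw [hS, insert_comm b a]) h.symm (Ne.symm hcn.1)
      (Ne.symm hcn.2.2) (Ne.symm hcn.2.1) h1

/-- The outer pair `{a, b}` of some `v ∈ S` makes the deficient set of `a` part of that of `v`, so
only three sets of size at most two matter and there are exactly six labels. A vertex in the other
deficient label of `v` then has an outer pair centred at `v`, whose partner shows that `a` touches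
all six labels. -/
lemma card_S_ne_four (hD : ∀ v, ∃ a b, CriticalPair G v a b) (hk : 6 ≤ #X.labels)
    (hstar : IsStarFree 6 G ∨ 7 ≤ #X.labels) : #X.S ≠ 4 := by
  intro h4
  obtain ⟨v, hv, a, b, h, ha, hb⟩ := exists_outer_of_card_four hD h4 (by omega)
  have hda := deficient_subset_of_criticalPair_mem h ha hb hv
  have hda1 : #(X.deficient a) ≤ 1 := (card_le_card hda).trans (card_singleton _).le
  have hm : ∀ x ∈ X.S, #(X.deficient x) ≤ 2 := by
    have h1 := card_labels_le_sum_add_choose (X := X) hD (by omega)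
    have h2 := card_filter_add_card_filter_not (s := X.S) (fun a => #(X.deficient a) ≤ 2)
    have haW : a ∈ ({a ∈ X.S | #(X.deficient a) ≤ 2} : Finset V) :=
      mem_filter.2 ⟨ha, by omega⟩
    rw [← add_sum_erase _ _ haW] at h1
    have h3 := sum_le_card_nsmul (({a ∈ X.S | #(X.deficient a) ≤ 2} : Finset V).erase a)
      (fun a => #(X.deficient a)) 2 (fun x hx => (mem_filter.1 (mem_of_mem_erase hx)).2)
    have hpos := card_pos.2 ⟨a, haW⟩
    rw [smul_eq_mul, card_erase_of_mem haW] at h3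
    -- Now the bound is `1 + 2 * (3 - z) + z.choose 2`, which reaches 6 only for `z = 0`.
    have h5 : #{a ∈ X.S | ¬#(X.deficient a) ≤ 2} = 0 := by
      generalize #{a ∈ X.S | ¬#(X.deficient a) ≤ 2} = z at *
      have hz : z ≤ 3 := by omega
      interval_cases z <;> simp [Nat.choose] at h1 <;> omega
    intro x hx
    by_contra hcon
    rw [card_eq_zero] at h5
    have : x ∈ ({a ∈ X.S | ¬#(X.deficient a) ≤ 2} : Finset V) := mem_filter.2 ⟨hx, hcon⟩
    rw [h5] at this
    simp at this
  have hva : v ≠ a := h.ne_left.symm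
  obtain ⟨c, d, hcd, hcdS⟩ : ∃ c d, c ≠ d ∧ (X.S.erase v).erase a = {c, d} := by
    apply card_eq_two.1
    rw [card_erase_of_mem (mem_erase.2 ⟨h.ne_left, ha⟩), card_erase_of_mem hv, h4]
  have hcS : c ∈ X.S := mem_of_mem_erase (mem_of_mem_erase (hcdS ▸ mem_insert_self c {d}))
  have hdS : d ∈ X.S := mem_of_mem_erase (mem_of_mem_erase
    (hcdS ▸ mem_insert_of_mem (mem_singleton_self d)))
  have hSmem : ∀ x ∈ X.S, x = v ∨ x = a ∨ x = c ∨ x = d := by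
    intro x hx
    by_cases h1 : x = v
    · exact Or.inl h1
    by_cases h2 : x = a
    · exact Or.inr (Or.inl h2)
    have : x ∈ (X.S.erase v).erase a := mem_erase.2 ⟨h2, mem_erase.2 ⟨h1, hx⟩⟩
    rw [hcdS, mem_insert, mem_singleton] at this
    exact Or.inr (Or.inr this)
  have hsub : X.labels ⊆ (X.deficient v ∪ X.deficient a) ∪ (X.deficient c ∪ X.deficient d) := by
    refine (labels_subset_biUnion_deficient hD (by omega)).trans ?_
    intro i hi
    obtain ⟨x, hx, hxi⟩ := mem_biUnion.1 hi
    simp only [mem_union]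
    rcases hSmem x hx with rfl | rfl | rfl | rfl <;> tauto
  have hvb : X.label b ∈ X.deficient v :=
    label_mem_deficient hb fun h' => h.not_adj_right h'.symm
  have hva_union : X.deficient v ∪ X.deficient a = X.deficient v :=
    union_eq_left.2 (hda.trans (by simpa using hvb))
  rw [hva_union] at hsub
  have hc1 := card_le_card hsub
  have hc2 := card_union_add_card_inter (X.deficient v) (X.deficient c ∪ X.deficient d)
  have hc3 := card_union_le (X.deficient c) (X.deficient d)
  have hv2 := hm v hv
  have hc4 := hm c hcS
  have hd4 := hm d hdS
  have hG : IsStarFree 6 G := hstar.resolve_right (by omega)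
  have hdisj : Disjoint (X.deficient v) (X.deficient c ∪ X.deficient d) := by
    rw [disjoint_iff_inter_eq_empty, ← card_eq_zero]
    omega
  have htouch := X.card_touched_lt hG a
  have hfull : X.deficient a = {X.label b} := by
    refine (subset_singleton_iff.1 hda).resolve_left fun h1 => ?_
    have := card_labels_le (X := X) a
    rw [h1, card_empty] at this
    omega
  obtain ⟨j, hjb, hvj⟩ := exists_eq_pair_of_card_eq_two (by omega : #(X.deficient v) = 2) hvb
  obtain ⟨w, hw, hwj, -⟩ := mem_deficient.1 (by rw [hvj]; simp : j ∈ X.deficient v)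
  have hwv : ∀ x ∈ X.S, ¬G.Adj x w → x = v := by
    intro x hx hxw
    have h1 := label_mem_deficient hw hxw
    rw [hwj] at h1
    have h2 : j ∉ X.deficient c ∪ X.deficient d :=
      disjoint_left.1 hdisj (by rw [hvj]; simp)
    rw [mem_union, not_or] at h2
    rcases hSmem x hx with rfl | rfl | rfl | rfl
    · rfl
    · rw [hfull] at h1
      exact absurd (by simpa using h1) hjb
    · exact absurd h1 h2.1
    · exact absurd h1 h2.2
  rcases outer_or_inner (X := X) hD (by omega) w with ⟨p, q, hpq, hp, hq⟩ | ⟨p, q, hpq, hp, hq⟩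
  · obtain rfl := hwv p hp hpq.not_adj_left
    have hql : X.label q = X.label b := by
      have h1 := deficient_subset_of_criticalPair hpq hp hq hvb
      rw [hwj, mem_insert, mem_singleton] at h1
      exact (h1.resolve_left hjb.symm).symm
    have hqa : G.Adj a q := by
      rcases hpq.dominates a (by rintro rfl; exact hw ha) with h1 | h1 | h1 | h1
      · exact absurd h1.symm hva
      · exact absurd ha (h1 ▸ hq)
      · exact absurd h1.symm h.not_adj_left
      · exact h1.symm
    have hall : X.labels ⊆ X.touched a := by
      intro i hi
      by_cases hib : i = X.label b
      · exact mem_touched.2 ⟨q, hq, hql.trans hib.symm, hqa⟩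
      · exact labels_sdiff_deficient_subset a (mem_sdiff.2 ⟨hi, by rw [hfull]; simpa using hib⟩)
    have := card_le_card hall
    omega
  · exact hpq.ne ((hwv p hp hpq.not_adj_left).trans (hwv q hq hpq.not_adj_right).symm)

/-! ### Separating sets with five vertices -/

/-- Handshake lemma for non-adjacency inside `S`. -/
lemma even_sum_card_missing : Even (∑ v ∈ X.S, #(X.missing v)) := by
  let H : SimpleGraph V :=
    { Adj := fun a b => a ∈ X.S ∧ b ∈ X.S ∧ a ≠ b ∧ ¬G.Adj a b
      symm := ⟨fun a b h => ⟨h.2.1, h.1, h.2.2.1.symm, fun h' => h.2.2.2 h'.symm⟩⟩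
      loopless := ⟨fun a h => h.2.2.1 rfl⟩ }
  have hdeg : ∀ v, H.degree v = if v ∈ X.S then #(X.missing v) else 0 := by
    intro v
    rw [← SimpleGraph.card_neighborFinset_eq_degree]
    split_ifs with hv
    · congr 1
      ext a
      rw [SimpleGraph.mem_neighborFinset, H.adj_comm, mem_missing]
      simp [H, hv]
    · rw [card_eq_zero, eq_empty_iff_forall_notMem]
      intro a ha
      rw [SimpleGraph.mem_neighborFinset] at ha
      exact hv ha.1
  have h := H.sum_degrees_eq_twice_card_edges
  simp only [hdeg] at h
  rw [← sum_filter, filter_univ_mem] at h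
  rw [h]
  exact even_two_mul _

/-- At most two of the ten pairs in `S` are unused, and the only used pair inside `X.missing v` is
`p v`; so the size is 2 or 3. Size 3 forces `X.missing v` to be the union of the two unused pairs,
hence occurs at most once, and a single 3 makes the degree sum odd. -/
lemma card_missing_eq_two {U : Finset V} (h5 : #X.S = 5) (hSU : X.S ⊆ U) (hU : 8 ≤ #U)
    {p : V → Finset V}
    (hp : ∀ u ∈ U, #(p u) = 2 ∧ p u ⊆ X.missing u ∧ ∀ u', p u ⊆ X.missing u' → u' = u) :
    ∀ v ∈ X.S, #(X.missing v) = 2 := by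
  set F := powersetCard 2 X.S \ U.image p with hF
  have hFcard : #F ≤ 2 := by
    have h1 := card_sdiff_add_card_eq_card (image_pairs_subset hp)
    rw [← hF, card_powersetCard, h5, card_image_of_injOn (injOn_pairs hp)] at h1
    have : Nat.choose 5 2 = 10 := by decide
    omega
  have hsub : ∀ v ∈ X.S, powersetCard 2 (X.missing v) ⊆ insert (p v) F := by
    intro v _ e he
    rw [mem_powersetCard] at he
    by_cases hep : e ∈ U.image p
    · obtain ⟨u, hu, rfl⟩ := mem_image.1 hep
      rw [(hp u hu).2.2 v he.1]
      exact mem_insert_self _ _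
    · exact mem_insert_of_mem (mem_sdiff.2
        ⟨mem_powersetCard.2 ⟨he.1.trans (missing_subset v), he.2⟩, hep⟩)
  have hins : ∀ v, #(insert (p v) F) ≤ 3 := fun v => (card_insert_le _ _).trans (by omega)
  have h2 : ∀ v ∈ X.S, 2 ≤ #(X.missing v) := by
    intro v hv
    have h := hp v (hSU hv)
    rw [← h.1]
    exact card_le_card h.2.1
  have h3 : ∀ v ∈ X.S, #(X.missing v) ≤ 3 := by
    intro v hv
    have h := (card_le_card (hsub v hv)).trans (hins v)
    rw [card_powersetCard] at h
    by_contra! h4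
    have := Nat.choose_le_choose 2 (show 4 ≤ #(X.missing v) from h4)
    have : Nat.choose 4 2 = 6 := by decide
    omega
  have heq : ∀ v ∈ X.S, #(X.missing v) = 3 → powersetCard 2 (X.missing v) = insert (p v) F := by
    intro v hv hv3
    refine eq_of_subset_of_card_le (hsub v hv) ((hins v).trans ?_)
    rw [card_powersetCard, hv3]
    decide
  have huni : ∀ v ∈ X.S, ∀ w ∈ X.S, #(X.missing v) = 3 → #(X.missing w) = 3 → w = v := by
    intro v hv w hw hv3 hw3
    have hev := heq v hv hv3
    have hew := heq w hw hw3
    have hF2 : 1 < #F := by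
      have h1 := card_insert_le (p v) F
      rw [← hev, card_powersetCard, hv3] at h1
      have : Nat.choose 3 2 = 3 := by decide
      omega
    obtain ⟨e, he, e', he', hne⟩ := one_lt_card.1 hF2
    have hmem : ∀ e ∈ F, #e = 2 := fun e he =>
      (mem_powersetCard.1 (mem_sdiff.1 he).1).2
    have hall : ∀ x ∈ X.S, #(X.missing x) = 3 → X.missing x = e ∪ e' := by
      intro x hx hx3
      have hxe := heq x hx hx3
      have hs : ∀ e ∈ F, e ⊆ X.missing x := fun e he =>
        (mem_powersetCard.1 (hxe ▸ mem_insert_of_mem he : e ∈ powersetCard 2 (X.missing x))).1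
      symm
      refine eq_of_subset_of_card_le (union_subset (hs e he) (hs e' he')) ?_
      rw [hx3]
      by_contra! hlt
      have h1 : #e = #(e ∪ e') := by
        have := card_le_card (subset_union_left : e ⊆ e ∪ e')
        have := hmem e he
        omega
      have h2 : e = e ∪ e' := eq_of_subset_of_card_le subset_union_left h1.ge
      have h3 : e' = e := eq_of_subset_of_card_le (union_eq_left.1 h2.symm)
        (by rw [hmem e he, hmem e' he'])
      exact hne h3.symm
    have hvw : X.missing v = X.missing w := (hall v hv hv3).trans (hall w hw hw3).symm
    exact (hp v (hSU hv)).2.2 w (hvw ▸ (hp v (hSU hv)).2.1)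
  intro v hv
  by_contra hv2
  have hv3 : #(X.missing v) = 3 := by
    have := h2 v hv
    have := h3 v hv
    omega
  have hsum := even_sum_card_missing (X := X)
  rw [← add_sum_erase _ _ hv, hv3, sum_congr rfl (g := fun _ => 2), sum_const,
    card_erase_of_mem hv, h5] at hsum
  · exact absurd hsum (by decide)
  · intro w hw
    have hwS := mem_of_mem_erase hw
    have h4 := h2 w hwS
    have h6 := h3 w hwS
    have : #(X.missing w) ≠ 3 := fun h => ne_of_mem_erase hw (huni v hv w hwS hv3 h)
    omega

-- Two 2-sets inside the three remaining vertices of `S` meet: non-adjacency on `S` behaves as in a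
-- 5-cycle.
omit [Fintype V] in
lemma exists_missing_eq_of_adj (h5 : #X.S = 5) (h2 : ∀ v ∈ X.S, #(X.missing v) = 2) {x y : V}
    (hx : x ∈ X.S) (hy : y ∈ X.S) (hxy : G.Adj x y) : ∃ v ∈ X.S, X.missing v = {x, y} := by
  have hsub : X.missing x ∪ X.missing y ⊆ (X.S.erase x).erase y := by
    intro v hv
    rw [mem_erase, mem_erase]
    rcases mem_union.1 hv with h | h
    · refine ⟨?_, ?_, missing_subset _ h⟩ <;> rintro rfl
      · exact (mem_missing.1 h).2.2 hxy.symm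
      · exact (mem_missing.1 h).2.1 rfl
    · refine ⟨?_, ?_, missing_subset _ h⟩ <;> rintro rfl
      · exact (mem_missing.1 h).2.1 rfl
      · exact (mem_missing.1 h).2.2 hxy
  have h1 := card_le_card hsub
  rw [card_erase_of_mem (mem_erase.2 ⟨hxy.ne.symm, hy⟩), card_erase_of_mem hx, h5] at h1
  have h3 := card_union_add_card_inter (X.missing x) (X.missing y)
  rw [h2 x hx, h2 y hy] at h3
  obtain ⟨v, hv⟩ := card_pos.1 (by omega : 0 < #(X.missing x ∩ X.missing y))
  rw [mem_inter] at hv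
  have hvS := missing_subset _ hv.1
  refine ⟨v, hvS, ?_⟩
  symm
  refine eq_of_subset_of_card_le ?_ ?_
  · simp only [insert_subset_iff, singleton_subset_iff]
    exact ⟨mem_missing_comm hx hv.1, mem_missing_comm hy hv.2⟩
  · rw [h2 v hvS, card_pair hxy.ne]

/-- With `r + 1` labels the star bound is tight: `a` touches exactly the labels other than those of
`u` and `b`. A second vertex in the fiber of `u` would be a neighbour of `a`. -/
lemma outer_structure {r : ℕ} (hG : IsStarFree r G) (hk : #X.labels = r + 1) {u a b : V}
    (h : CriticalPair G u a b) (ha : a ∈ X.S) (hb : b ∉ X.S) :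
    X.label b ≠ X.label u ∧ X.label u ∉ X.touched a ∧ X.label b ∉ X.touched a ∧
      ∀ t, t ∉ X.S → X.label t = X.label u → t = u := by
  have hsub : X.labels ⊆ X.touched a ∪ ({X.label u, X.label b} \ X.touched a) := by
    intro i hi
    rw [union_sdiff_self_eq_union, mem_union]
    by_cases hd : i ∈ X.deficient a
    · exact Or.inr (deficient_subset_of_criticalPair h ha hb hd)
    · exact Or.inl (labels_sdiff_deficient_subset a (mem_sdiff.2 ⟨hi, hd⟩))
  have h1 := (card_le_card hsub).trans (card_union_le _ _)
  have h2 := X.card_touched_lt hG a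
  have h3 := card_le_two (a := X.label u) (b := X.label b)
  have h4 : ({X.label u, X.label b} : Finset κ) \ X.touched a = {X.label u, X.label b} :=
    eq_of_subset_of_card_le sdiff_subset (by omega)
  have h5 : X.label b ≠ X.label u := by
    intro h'
    rw [h4, h', pair_eq_singleton, card_singleton] at h1
    omega
  have hmem : ∀ i ∈ ({X.label u, X.label b} : Finset κ), i ∉ X.touched a := by
    intro i hi
    rw [← h4] at hi
    exact (mem_sdiff.1 hi).2
  have h6 := hmem (X.label u) (by simp)
  refine ⟨h5, h6, hmem _ (by simp), fun t ht htu => ?_⟩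
  by_contra hne
  exact h6 (mem_touched.2 ⟨t, ht, htu,
    adj_of_criticalPair h ha hb ht hne (by rw [htu]; exact h5.symm)⟩)

/-- Some fiber `i₀` has three vertices, all with inner pairs. Vertices with outer pairs come in
couples sharing a centre that is joined to the whole fiber `i₀`; at least two centres occur, so the
pairs of that fiber live on the at most three other vertices of `S` and use all pairs there. This
conflicts with the 2-regular non-adjacency of `S`. -/
lemma card_S_ne_five {r : ℕ} (hG : IsStarFree r G) (hD : ∀ v, ∃ a b, CriticalPair G v a b)
    (hr : 6 ≤ r) (hk : r + 1 ≤ #X.oddLabels) (hV : Fintype.card V ≠ r + 6) : #X.S ≠ 5 := by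
  intro h5
  have hle := X.card_oddLabels_le
  have hk' : #X.labels = r + 1 := by
    by_contra hne
    have := six_le_card_of_inner (X := X)
      (inner_of_star_free hG hD (by omega) (by omega)) (by omega)
    omega
  have hodd : ∀ i ∈ X.labels, Odd #(X.fiber i) := by
    have : X.oddLabels = X.labels := eq_of_subset_of_card_le X.oddLabels_subset (by omega)
    intro i hi
    rw [← this] at hi
    exact (mem_filter.1 hi).2
  have hcompl := X.card_add_card_compl
  have hsum := X.sum_card_fiber
  -- Otherwise all odd fibers are singletons and the order is `5 + (r + 1)`, which `hV` excludes.
  obtain ⟨i₀, hi₀, hi₀3⟩ : ∃ i ∈ X.labels, 3 ≤ #(X.fiber i) := by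
    by_contra! hcon
    have : ∑ i ∈ X.labels, #(X.fiber i) = ∑ i ∈ X.labels, 1 := by
      refine sum_congr rfl fun i hi => ?_
      have h1 := hcon i hi
      have h2 := hodd i hi
      rw [Nat.odd_iff] at h2
      omega
    rw [sum_const, smul_eq_mul, mul_one] at this
    omega
  have hN : r + 3 ≤ #X.Sᶜ := by
    rw [← hsum, ← add_sum_erase _ _ hi₀]
    have h1 := card_nsmul_le_sum (X.labels.erase i₀) (fun i => #(X.fiber i)) 1
      (fun i hi => (hodd i (mem_of_mem_erase hi)).pos)
    rw [card_erase_of_mem hi₀, smul_eq_mul, mul_one] at h1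
    omega
  set V₁ : Finset V := {u | u ∉ X.S ∧ X.Outer u} with hV₁
  have hV₁mem : ∀ u, u ∈ V₁ ↔ u ∉ X.S ∧ X.Outer u := by simp [hV₁]
  have hin : ∀ u ∈ V₁ᶜ, X.Inner u := by
    intro u hu
    rw [mem_compl, hV₁mem] at hu
    by_cases huS : u ∈ X.S
    · exact inner_of_star_free_of_mem hG hD (by omega) (by omega) huS
    · exact (outer_or_inner hD (by omega : 4 ≤ #X.labels) u).resolve_left fun h => hu ⟨huS, h⟩
  obtain ⟨p, hp⟩ := exists_pairs V₁ᶜ hin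
  have hSV : X.S ⊆ V₁ᶜ := fun v hv => by
    rw [mem_compl, hV₁mem]
    exact fun h => h.1 hv
  have hsingle : ∀ u ∈ V₁, ∀ t, t ∉ X.S → X.label t = X.label u → t = u := by
    intro u hu
    obtain ⟨hu, a, b, h, ha, hb⟩ := (hV₁mem u).1 hu
    exact (outer_structure hG hk' h ha hb).2.2.2
  have hlab : ∀ u ∈ V₁, X.label u ≠ i₀ := by
    rintro u hu rfl
    have : X.fiber (X.label u) ⊆ {u} := by
      intro t ht
      rw [mem_fiber] at ht
      exact mem_singleton.2 (hsingle u hu t ht.1 ht.2)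
    have := card_le_card this
    rw [card_singleton] at this
    omega
  have hfibV : X.fiber i₀ ⊆ V₁ᶜ := by
    intro x hx
    rw [mem_compl]
    exact fun h => hlab x h (mem_fiber.1 hx).2
  have hcV₁ : #V₁ᶜ ≤ 10 := by
    have := card_le_choose_of_inner V₁ᶜ hin
    rw [h5] at this
    exact this
  have hcV₁8 : 8 ≤ #V₁ᶜ := by
    have hdisj : Disjoint X.S (X.fiber i₀) := disjoint_left.2 fun v hv h =>
      (mem_fiber.1 h).1 hv
    have := card_le_card (union_subset hSV hfibV)
    rw [card_union_of_disjoint hdisj] at this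
    omega
  have h2 := card_missing_eq_two h5 hSV hcV₁8 hp
  have hpm : ∀ v ∈ X.S, p v = X.missing v := fun v hv =>
    eq_of_subset_of_card_le (hp v (hSV hv)).2.1 (by rw [h2 v hv, (hp v (hSV hv)).1])
  have hmiss : ∀ u a b, u ∉ X.S → CriticalPair G u a b → a ∈ X.S → b ∉ X.S →
      X.missing b = {a} := by
    intro u a b hu h ha hb
    have hab : ¬G.Adj a b := fun h' =>
      (outer_structure hG hk' h ha hb).2.2.1 (mem_touched.2 ⟨b, hb, rfl, h'⟩)
    ext x
    rw [mem_singleton]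
    constructor
    · intro hx
      by_contra hxa
      have hx' := mem_missing.1 hx
      rcases h.dominates x (by rintro rfl; exact hu hx'.1) with h1 | h1 | h1 | h1
      · exact hxa h1
      · exact hx'.2.1 h1
      · obtain ⟨v, hv, hve⟩ := exists_missing_eq_of_adj h5 h2 ha hx'.1 h1
        have hsub : p v ⊆ X.missing b := by
          rw [hpm v hv, hve]
          simp only [insert_subset_iff, singleton_subset_iff]
          exact ⟨mem_missing.2 ⟨ha, h.ne, hab⟩, hx⟩
        have := (hp v (hSV hv)).2.2 b hsub
        exact hb (this ▸ hv)
      · exact hx'.2.2 h1.symm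
    · rintro rfl
      exact mem_missing.2 ⟨ha, h.ne, hab⟩
  have hcenter : ∀ u ∈ V₁, ∃ a, X.missing u = {a} ∧ #(X.deficient a) ≤ 2 ∧
      i₀ ∉ X.deficient a := by
    intro u hu
    obtain ⟨huS, a, b, h, ha, hb⟩ := (hV₁mem u).1 hu
    have hbm := hmiss u a b huS h ha hb
    -- An inner pair of `b` would be a 2-set inside the singleton `X.missing b`.
    have hbV : b ∈ V₁ := by
      by_contra hbV
      have h1 := hp b (mem_compl.2 hbV)
      have h3 := card_le_card h1.2.1
      rw [h1.1, hbm, card_singleton] at h3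
      omega
    obtain ⟨-, a', c, h', ha', hc⟩ := (hV₁mem b).1 hbV
    have haa : a' = a := by
      have := left_mem_missing h' ha'
      rwa [hbm, mem_singleton] at this
    subst haa
    have hsub := deficient_subset_of_criticalPair h ha hb
    obtain ⟨hcb, -, hct, -⟩ := outer_structure hG hk' h' ha hc
    have hcu : c = u := by
      apply hsingle u hu c hc
      have hcd : X.label c ∈ X.deficient a' :=
        label_mem_deficient hc fun h1 => hct (mem_touched.2 ⟨c, hc, rfl, h1⟩)
      have := hsub hcd
      rw [mem_insert, mem_singleton] at this
      exact this.resolve_right hcb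
    subst hcu
    refine ⟨a', hmiss b a' c hb h' ha hc, (card_le_card hsub).trans card_le_two, fun hi => ?_⟩
    have := hsub hi
    rw [mem_insert, mem_singleton] at this
    rcases this with h1 | h1
    · exact hlab c hu h1.symm
    · exact hlab b hbV h1.symm
  choose! ctr hctr using hcenter
  have hctrS : ∀ u ∈ V₁, ctr u ∈ X.S ∧ ¬G.Adj (ctr u) u := by
    intro u hu
    have h1 : ctr u ∈ X.missing u := by rw [(hctr u hu).1]; simp
    rw [mem_missing] at h1
    exact ⟨h1.1, h1.2.2⟩
  have hV₁4 : 4 ≤ #V₁ := by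
    have := Finset.card_add_card_compl V₁
    omega
  -- Each centre serves at most two vertices of `V₁`, because their labels are distinct and
  -- deficient for it.
  have hZ : 2 ≤ #(V₁.image ctr) := by
    have h1 := card_le_mul_card_image (f := ctr) V₁ 2 (fun z hz => by
      obtain ⟨w, hw, rfl⟩ := mem_image.1 hz
      refine le_trans ?_ (hctr w hw).2.1
      refine card_le_card_of_injOn X.label ?_ ?_
      · intro u hu
        obtain ⟨hu, huw⟩ := mem_filter.1 (mem_coe.1 hu)
        rw [← huw]
        exact label_mem_deficient ((hV₁mem u).1 hu).1 (hctrS u hu).2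
      · intro u hu t ht hut
        have hu' := (mem_filter.1 (mem_coe.1 hu)).1
        have ht' := (mem_filter.1 (mem_coe.1 ht)).1
        exact hsingle t ht' u ((hV₁mem u).1 hu').1 hut)
    omega
  set T := X.S \ V₁.image ctr with hT
  have hTS : T ⊆ X.S := sdiff_subset
  have hT3 : #T ≤ 3 := by
    have h1 : V₁.image ctr ⊆ X.S := by
      intro z hz
      obtain ⟨w, hw, rfl⟩ := mem_image.1 hz
      exact (hctrS w hw).1
    have := card_sdiff_add_card_eq_card h1
    rw [← hT] at this
    omega
  have himg : (X.fiber i₀).image p ⊆ powersetCard 2 T := by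
    intro e he
    obtain ⟨x, hx, rfl⟩ := mem_image.1 he
    have h1 := hp x (hfibV hx)
    refine mem_powersetCard.2 ⟨fun y hy => ?_, h1.1⟩
    have hy' := mem_missing.1 (h1.2.1 hy)
    refine mem_sdiff.2 ⟨hy'.1, fun hyi => ?_⟩
    obtain ⟨u, hu, rfl⟩ := mem_image.1 hyi
    rw [mem_fiber] at hx
    exact (hctr u hu).2.2 (hx.2 ▸ label_mem_deficient hx.1 hy'.2.2)
  have hinj : Set.InjOn p (X.fiber i₀) := (injOn_pairs hp).mono (coe_subset.2 hfibV)
  have hTcard : #T = 3 := by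
    have h1 := card_le_card himg
    rw [card_image_of_injOn hinj, card_powersetCard] at h1
    by_contra hne
    have := Nat.choose_le_choose 2 (by omega : #T ≤ 2)
    have : Nat.choose 2 2 = 1 := by decide
    omega
  have heq : (X.fiber i₀).image p = powersetCard 2 T := by
    refine eq_of_subset_of_card_le himg ?_
    rw [card_image_of_injOn hinj, card_powersetCard, hTcard]
    exact hi₀3
  have hno : ∀ x ∈ T, ∀ y ∈ T, x ≠ y → ∀ v ∈ X.S, ¬({x, y} : Finset V) ⊆ X.missing v := by
    intro x hx y hy hxy v hv hsub
    have h1 : ({x, y} : Finset V) ∈ powersetCard 2 T := by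
      refine mem_powersetCard.2 ⟨?_, card_pair hxy⟩
      simp [insert_subset_iff, hx, hy]
    rw [← heq] at h1
    obtain ⟨w, hw, hwe⟩ := mem_image.1 h1
    have := (hp w (hfibV hw)).2.2 v (hwe ▸ hsub)
    exact (mem_fiber.1 hw).1 (this ▸ hv)
  have hnadj : ∀ x ∈ T, ∀ y ∈ T, x ≠ y → ¬G.Adj x y := by
    intro x hx y hy hxy hadj
    obtain ⟨v, hv, hve⟩ := exists_missing_eq_of_adj h5 h2 (hTS hx) (hTS hy) hadj
    exact hno x hx y hy hxy v hv hve.ge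
  obtain ⟨x, y, z, hxy, hxz, hyz, hTe⟩ := card_eq_three.1 hTcard
  have hx : x ∈ T := by simp [hTe]
  have hy : y ∈ T := by simp [hTe]
  have hz : z ∈ T := by simp [hTe]
  refine hno x hx y hy hxy z (hTS hz) ?_
  simp only [insert_subset_iff, singleton_subset_iff, mem_missing]
  exact ⟨⟨hTS hx, hxz, hnadj x hx z hz hxz⟩, hTS hy, hyz, hnadj y hy z hz hyz⟩

/-! ### Separating sets with at least six vertices -/

lemma exists_transversal (X : LabelledCut G κ) :
    ∃ R : Finset V, (∀ u ∈ R, u ∉ X.S) ∧ Set.InjOn X.label R ∧ #R = #X.labels := by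
  by_cases hne : Nonempty V
  · have h : ∀ i ∈ X.labels, ∃ v, v ∉ X.S ∧ X.label v = i := fun i hi => mem_labels.1 hi
    choose! f hf1 hf2 using h
    refine ⟨X.labels.image f, ?_, ?_, card_image_of_injOn ?_⟩
    · intro u hu
      obtain ⟨i, hi, rfl⟩ := mem_image.1 hu
      exact hf1 i hi
    · intro u hu v hv huv
      obtain ⟨i, hi, rfl⟩ := mem_image.1 (mem_coe.1 hu)
      obtain ⟨j, hj, rfl⟩ := mem_image.1 (mem_coe.1 hv)
      rw [hf2 i hi, hf2 j hj] at huv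
      rw [huv]
    · intro i hi j hj hij
      rw [← hf2 i hi, ← hf2 j hj, hij]
  · have h : X.labels = ∅ := by
      rw [eq_empty_iff_forall_notMem]
      intro i hi
      exact hne ⟨(mem_labels.1 hi).choose⟩
    exact ⟨∅, by simp, by simp, by simp [h]⟩

/-- The neighbours of `a` in the transversal have distinct touched labels, so there are fewer than
`r` of them. -/
lemma card_labels_lt_add_of_transversal {r : ℕ} (hG : IsStarFree r G) {R : Finset V}
    (hRS : ∀ u ∈ R, u ∉ X.S) (hinj : Set.InjOn X.label R) (hR : #R = #X.labels) {a : V}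
    (ha : a ∈ X.S) : #X.labels < #{u ∈ R | a ∈ X.missing u} + r := by
  have h1 := card_filter_add_card_filter_not (s := R) (fun u => a ∈ X.missing u)
  have h2 : #{u ∈ R | ¬a ∈ X.missing u} ≤ #(X.touched a) := by
    refine card_le_card_of_injOn X.label ?_ (hinj.mono (coe_subset.2 (filter_subset _ _)))
    intro u hu
    obtain ⟨hu, hau⟩ := mem_filter.1 (mem_coe.1 hu)
    have huS := hRS u hu
    rw [mem_missing] at hau
    refine mem_touched.2 ⟨u, huS, rfl, ?_⟩
    by_contra h
    exact hau ⟨ha, by rintro rfl; exact huS ha, h⟩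
  have h3 := X.card_touched_lt hG a
  omega

/-- The inner pair of a vertex of `S` dominates everything outside `S`, and each of its members
touches at most `r - 1` labels. -/
lemma card_labels_add_two_le {r : ℕ} (hG : IsStarFree r G) (hin : ∀ u, X.Inner u)
    (hS : X.S.Nonempty) : #X.labels + 2 ≤ 2 * r := by
  obtain ⟨v, hv⟩ := hS
  obtain ⟨a, b, h, ha, hb⟩ := hin v
  have hsub : X.labels ⊆ X.touched a ∪ X.touched b := by
    intro i hi
    obtain ⟨w, hw, rfl⟩ := mem_labels.1 hi
    rw [mem_union]
    rcases h.dominates w (by rintro rfl; exact hw hv) with rfl | rfl | h1 | h1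
    · exact absurd ha hw
    · exact absurd hb hw
    · exact Or.inl (mem_touched.2 ⟨w, hw, rfl, h1⟩)
    · exact Or.inr (mem_touched.2 ⟨w, hw, rfl, h1⟩)
  have h1 := (card_le_card hsub).trans (card_union_le _ _)
  have h2 := X.card_touched_lt hG a
  have h3 := X.card_touched_lt hG b
  omega

section Pairs

variable {p : V → Finset V}
  (hp : ∀ u, #(p u) = 2 ∧ p u ⊆ X.missing u ∧ ∀ u', p u ⊆ X.missing u' → u' = u)

include hp

omit [Fintype V] in
lemma pairs_injective : Function.Injective p := fun u v huv =>
  ((hp u).2.2 v (huv ▸ (hp v).2.1)).symm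

/-- If the critical pairs in `S` contain no triangle then Mantel's bound applies. -/
lemma card_le_of_triangle_free
    (htri : ∀ a b c, {a, b} ∈ univ.image p → {a, c} ∈ univ.image p →
      {b, c} ∈ univ.image p → False) :
    Fintype.card V ≤ (#X.S ^ 2 - (#X.S % 2) ^ 2) * (2 - 1) / (2 * 2) + (#X.S % 2).choose 2 := by
  let H : SimpleGraph X.S :=
    { Adj := fun a b => a ≠ b ∧ ({(a : V), (b : V)} : Finset V) ∈ univ.image p
      symm := ⟨fun a b h => ⟨h.1.symm, by rw [pair_comm]; exact h.2⟩⟩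
      loopless := ⟨fun a h => h.1 rfl⟩ }
  have hfree : H.CliqueFree (2 + 1) := by
    intro T hT
    obtain ⟨a, b, c, hab, hac, hbc, -⟩ := SimpleGraph.is3Clique_iff.1 hT
    exact htri a b c hab.2 hac.2 hbc.2
  -- Turán's bound for triangle-free graphs; the edges of `H` are the pairs `p u`, one for each
  -- vertex of `G`.
  have h := hfree.card_edgeFinset_le
  rw [Fintype.card_coe] at h
  refine le_trans ?_ h
  have h1 : univ.image p ⊆ H.edgeFinset.image fun e => (e.map Subtype.val).toFinset := by
    intro e he
    obtain ⟨u, -, rfl⟩ := mem_image.1 he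
    obtain ⟨a, b, hab, hpu⟩ := card_eq_two.1 (hp u).1
    have hsub := (hp u).2.1.trans (missing_subset u)
    rw [hpu] at hsub he
    have ha : a ∈ X.S := hsub (by simp)
    have hb : b ∈ X.S := hsub (by simp)
    refine mem_image.2 ⟨s(⟨a, ha⟩, ⟨b, hb⟩), ?_, ?_⟩
    · rw [SimpleGraph.mem_edgeFinset, SimpleGraph.mem_edgeSet]
      exact ⟨fun h => hab (congrArg Subtype.val h), he⟩
    · rw [hpu]
      ext x
      simp
  have h2 := (card_le_card h1).trans card_image_le
  rwa [card_image_of_injective _ (pairs_injective hp), card_univ] at h2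

/-- The members of a triangle each miss at least `#X.labels - r + 1` transversal vertices, and two
of them jointly miss at most one, so `3 * (#X.labels - r) ≤ #X.labels`. -/
lemma no_triangle {r : ℕ} (hG : IsStarFree r G) (hk : 3 * r < 2 * #X.labels) (a b c : V)
    (h1 : {a, b} ∈ univ.image p)
    (h2 : {a, c} ∈ univ.image p) (h3 : {b, c} ∈ univ.image p) : False := by
  obtain ⟨R, hRS, hinj, hR⟩ := X.exists_transversal
  set I : V → Finset V := fun a => {u ∈ R | a ∈ X.missing u} with hI
  have hinter : ∀ a b, ({a, b} : Finset V) ∈ univ.image p → #(I a ∩ I b) ≤ 1 := by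
    intro a b h
    obtain ⟨w, -, hw⟩ := mem_image.1 h
    have : Nonempty V := ⟨w⟩
    refine card_le_one_iff_subset_singleton.2 ⟨w, fun u hu => ?_⟩
    rw [mem_inter, mem_filter, mem_filter] at hu
    refine mem_singleton.2 ((hp w).2.2 u ?_)
    rw [hw]
    simp only [insert_subset_iff, singleton_subset_iff]
    exact ⟨hu.1.2, hu.2.2⟩
  have hS : ∀ a b, ({a, b} : Finset V) ∈ univ.image p → a ∈ X.S ∧ b ∈ X.S := by
    intro a b h
    obtain ⟨w, -, hw⟩ := mem_image.1 h
    have hsub := (hp w).2.1.trans (missing_subset w)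
    rw [hw] at hsub
    exact ⟨hsub (by simp), hsub (by simp)⟩
  have ha : #X.labels < #(I a) + r :=
    card_labels_lt_add_of_transversal hG hRS hinj hR (hS a b h1).1
  have hb : #X.labels < #(I b) + r :=
    card_labels_lt_add_of_transversal hG hRS hinj hR (hS a b h1).2
  have hc : #X.labels < #(I c) + r :=
    card_labels_lt_add_of_transversal hG hRS hinj hR (hS a c h2).2
  have h4 := card_union_add_card_inter (I a) (I b)
  have h5 := card_union_add_card_inter (I a ∪ I b) (I c)
  have h6 : #((I a ∪ I b) ∩ I c) ≤ #(I a ∩ I c) + #(I b ∩ I c) := by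
    rw [union_inter_distrib_right]
    exact card_union_le _ _
  have h7 : #(I a ∪ I b ∪ I c) ≤ #R :=
    card_le_card (union_subset (union_subset (filter_subset _ _) (filter_subset _ _))
      (filter_subset _ _))
  have := hinter a b h1
  have := hinter a c h2
  have := hinter b c h3
  omega

/-- The vertices of `S` which form no critical pair together with `a`. -/
def unpaired (X : LabelledCut G κ) (p : V → Finset V) (a : V) : Finset V :=
  {b ∈ X.S | b ≠ a ∧ ({a, b} : Finset V) ∉ univ.image p}

omit hp in
lemma mem_unpaired_comm {a b : V} (ha : a ∈ X.S) (h : b ∈ X.unpaired p a) :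
    a ∈ X.unpaired p b := by
  rw [unpaired, mem_filter] at h ⊢
  exact ⟨ha, h.2.1.symm, by rw [pair_comm]; exact h.2.2⟩

/-- If `u` misses `a` and `a ∉ p u`, no member of `p u` forms a critical pair with `a`, since that
pair would belong to `u`. So `p u` is a 2-set of vertices unpaired with `a`. -/
lemma card_missing_le_add_choose (R : Finset V) {a : V} (ha : a ∈ X.S) :
    #{u ∈ R | a ∈ X.missing u} ≤ #{u ∈ R | a ∈ p u} + (#(X.unpaired p a)).choose 2 := by
  have hsub : {u ∈ R | a ∈ X.missing u} ⊆
      {u ∈ R | a ∈ p u} ∪ {u ∈ R | a ∈ X.missing u ∧ a ∉ p u} := by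
    intro u hu
    rw [mem_filter] at hu
    simp only [mem_union, mem_filter]
    tauto
  refine (card_le_card hsub).trans ((card_union_le _ _).trans (Nat.add_le_add_left ?_ _))
  rw [← card_powersetCard]
  refine card_le_card_of_injOn p ?_ (pairs_injective hp).injOn
  intro u hu
  obtain ⟨-, hau, hap⟩ := mem_filter.1 (mem_coe.1 hu)
  refine mem_coe.2 (mem_powersetCard.2 ⟨fun x hx => ?_, (hp u).1⟩)
  have hxm := (hp u).2.1 hx
  refine mem_filter.2 ⟨missing_subset u hxm, by rintro rfl; exact hap hx, fun h => ?_⟩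
  obtain ⟨w, -, hw⟩ := mem_image.1 h
  have hwu : u = w := (hp w).2.2 u (by
    rw [hw]
    simp only [insert_subset_iff, singleton_subset_iff]
    exact ⟨hau, hxm⟩)
  subst hwu
  exact hap (by simp [hw])

omit [Fintype V] in
lemma sum_card_filter_mem_pairs (R : Finset V) :
    ∑ a ∈ X.S, #{u ∈ R | a ∈ p u} = 2 * #R := by
  have h := sum_card_bipartiteAbove_eq_sum_card_bipartiteBelow (s := X.S) (t := R)
    (fun a u => a ∈ p u)
  simp only [bipartiteAbove, bipartiteBelow] at h
  rw [h, sum_congr rfl (g := fun _ => 2), sum_const, smul_eq_mul, mul_comm]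
  intro u _
  rw [← (hp u).1]
  congr 1
  ext a
  rw [mem_filter]
  exact ⟨fun h => h.2, fun h => ⟨missing_subset u ((hp u).2.1 h), h⟩⟩

lemma card_unpaired_add_le {a : V} (ha : a ∈ X.S) :
    #(X.unpaired p a) + #{u | a ∈ p u} + 1 ≤ #X.S := by
  have h1 := card_filter_add_card_filter_not (s := X.S.erase a)
    (fun b => ({a, b} : Finset V) ∈ univ.image p)
  have h2 : X.unpaired p a = {b ∈ X.S.erase a | ¬({a, b} : Finset V) ∈ univ.image p} := by
    ext b
    simp only [unpaired, mem_filter, mem_erase]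
    tauto
  have h3 : #{u | a ∈ p u} ≤ #{b ∈ X.S.erase a | ({a, b} : Finset V) ∈ univ.image p} := by
    rw [← card_image_of_injective _ (pairs_injective hp)]
    refine (card_le_card (t := ({b ∈ X.S.erase a | ({a, b} : Finset V) ∈ univ.image p}).image
      fun b => ({a, b} : Finset V)) ?_).trans card_image_le
    intro e he
    obtain ⟨u, hu, rfl⟩ := mem_image.1 he
    have hau : a ∈ p u := (mem_filter.1 hu).2
    obtain ⟨b, hba, hpu⟩ := exists_eq_pair_of_card_eq_two (hp u).1 hau
    refine mem_image.2 ⟨b, mem_filter.2 ⟨mem_erase.2 ⟨hba, ?_⟩, ?_⟩, hpu.symm⟩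
    · exact missing_subset u ((hp u).2.1 (by simp [hpu]))
    · exact mem_image.2 ⟨u, mem_univ _, hpu⟩
  rw [← h2, card_erase_of_mem ha] at h1
  have := card_pos.2 ⟨a, ha⟩
  omega

lemma sum_card_unpaired_add_le :
    ∑ a ∈ X.S, #(X.unpaired p a) + 2 * Fintype.card V + #X.S ≤ #X.S * #X.S := by
  have h1 := sum_le_card_nsmul X.S
    (fun a => #(X.unpaired p a) + #{u | a ∈ p u} + 1) #X.S
    (fun a ha => card_unpaired_add_le hp ha)
  rw [sum_add_distrib, sum_add_distrib, sum_card_filter_mem_pairs hp, sum_const, card_univ] at h1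
  simpa using h1

/-- For `a ∈ S` let `g` count the transversal pairs through `a` and `f` its unpaired vertices.
Star-freeness gives `g + f.choose 2 ≥ 4`, hence `g + f ≥ 4`, while the sum of `g + f` is at most
`28`. Equality forces `f = 0` or `f ≥ 3` everywhere. All `f = 0` would need 14 labels; otherwise
four vertices with `f ≥ 3` exceed the bound 10 on the sum of `f`. -/
lemma card_S_ne_seven {r : ℕ} (hG : IsStarFree r G) (hk : 9 ≤ #X.labels)
    (hr : r + 3 ≤ #X.labels) (hk' : #X.labels ≤ 12) : #X.S ≠ 7 := by
  intro h7
  obtain ⟨R, hRS, hinj, hR⟩ := X.exists_transversal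
  have hsum := sum_card_unpaired_add_le hp
  have hcompl := X.card_add_card_compl
  have hle := X.card_labels_le_card_compl
  have hg := sum_card_filter_mem_pairs hp R
  have hlow : ∀ a ∈ X.S, 4 ≤ #{u ∈ R | a ∈ p u} + (#(X.unpaired p a)).choose 2 := by
    intro a ha
    have h1 := card_labels_lt_add_of_transversal hG hRS hinj hR ha
    have h2 := card_missing_le_add_choose hp R ha
    omega
  have hlow' : ∀ a ∈ X.S, 4 ≤ #{u ∈ R | a ∈ p u} + #(X.unpaired p a) ∧
      (#{u ∈ R | a ∈ p u} + #(X.unpaired p a) = 4 →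
        #(X.unpaired p a) = 0 ∨ 3 ≤ #(X.unpaired p a)) := by
    intro a ha
    have h1 := hlow a ha
    generalize #(X.unpaired p a) = f at *
    rcases Nat.lt_or_ge f 4 with hf | hf
    · interval_cases f <;> simp [Nat.choose] at h1 ⊢ <;> omega
    · omega
  have heq : ∀ a ∈ X.S, #{u ∈ R | a ∈ p u} + #(X.unpaired p a) = 4 := by
    intro a ha
    have h1 := card_nsmul_le_sum (X.S.erase a)
      (fun a => #{u ∈ R | a ∈ p u} + #(X.unpaired p a)) 4
      (fun b hb => (hlow' b (mem_of_mem_erase hb)).1)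
    have h2 := add_sum_erase X.S (fun a => #{u ∈ R | a ∈ p u} + #(X.unpaired p a)) ha
    rw [card_erase_of_mem ha, h7, smul_eq_mul] at h1
    rw [sum_add_distrib (s := X.S)] at h2
    have h3 := (hlow' a ha).1
    rw [h7] at hsum
    omega
  have hf : ∀ a ∈ X.S, #(X.unpaired p a) = 0 ∨ 3 ≤ #(X.unpaired p a) := fun a ha =>
    (hlow' a ha).2 (heq a ha)
  obtain ⟨a, ha, hfa⟩ : ∃ a ∈ X.S, #(X.unpaired p a) ≠ 0 := by
    by_contra! hcon
    have h1 : ∑ a ∈ X.S, #{u ∈ R | a ∈ p u} = ∑ a ∈ X.S, 4 := sum_congr rfl fun a ha => by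
      have := heq a ha
      rw [hcon a ha] at this
      exact this
    rw [hg, sum_const, h7, smul_eq_mul] at h1
    omega
  have hfa3 : 3 ≤ #(X.unpaired p a) := (hf a ha).resolve_left hfa
  have hnb : ∀ b ∈ X.unpaired p a, 3 ≤ #(X.unpaired p b) := by
    intro b hb
    refine (hf b (mem_filter.1 hb).1).resolve_left fun h => ?_
    have := card_pos.2 ⟨a, mem_unpaired_comm ha hb⟩
    omega
  have h1 := card_nsmul_le_sum (X.unpaired p a) (fun b => #(X.unpaired p b)) 3 hnb
  have h2 : ∑ b ∈ insert a (X.unpaired p a), #(X.unpaired p b) ≤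
      ∑ b ∈ X.S, #(X.unpaired p b) := by
    refine sum_le_sum_of_subset (insert_subset ha ?_)
    exact filter_subset _ _
  rw [sum_insert (by simp [unpaired])] at h2
  rw [smul_eq_mul] at h1
  rw [h7] at hsum
  omega

/-- With `L` labels at most `18 - 2 * L ≤ 2` is left for the sum of the unpaired degrees, so `2 *
f.choose 2 ≤ f`. Summing the star bound over `S` gives `6 * (2 * L - 10) ≤ 4 * L + (18 - 2 * L)`,
that is `L ≤ 7`. -/
lemma card_S_ne_six (hG : IsStarFree 6 G) (hk : 8 ≤ #X.labels) : #X.S ≠ 6 := by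
  intro h6
  obtain ⟨R, hRS, hinj, hR⟩ := X.exists_transversal
  have hsum := sum_card_unpaired_add_le hp
  have hcompl := X.card_add_card_compl
  have hle := X.card_labels_le_card_compl
  have hg := sum_card_filter_mem_pairs hp R
  rw [h6] at hsum
  have hlow : ∀ a ∈ X.S, 
      2 * #X.labels - 10 ≤ 2 * #{u ∈ R | a ∈ p u} + #(X.unpaired p a) := by
    intro a ha
    have h1 := card_labels_lt_add_of_transversal hG hRS hinj hR ha
    have h2 := card_missing_le_add_choose hp R ha
    have h3 := single_le_sum (f := fun a => #(X.unpaired p a)) (fun _ _ => Nat.zero_le _) ha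
    generalize #(X.unpaired p a) = f at *
    have hf : f ≤ 2 := by omega
    interval_cases f <;> simp [Nat.choose] at h2 ⊢ <;> omega
  have h1 := card_nsmul_le_sum X.S _ _ hlow
  rw [sum_add_distrib, ← mul_sum, hg, h6, smul_eq_mul] at h1
  omega

end Pairs

/-- A separating set whose critical pairs all lie inside has six vertices, and in the
`K_{1,6}`-free case there is none. -/
lemma card_S_le_six {r d : ℕ} (hG : IsStarFree r G) (hin : ∀ u, X.Inner u) (hd : d = 2 ∨ d = 3)
    (hr : r = d + 4) (h6 : 6 ≤ #X.S) (hk : #X.S + d ≤ #X.labels) : #X.S = 6 ∧ d = 3 := by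
  obtain ⟨p, hp'⟩ := exists_pairs (X := X) univ fun u _ => hin u
  have hp : ∀ u, #(p u) = 2 ∧ p u ⊆ X.missing u ∧ ∀ u', p u ⊆ X.missing u' → u' = u :=
    fun u => hp' u (mem_univ u)
  have hk2 := card_labels_add_two_le hG hin (card_pos.1 (by omega : 0 < #X.S))
  have hcompl := X.card_add_card_compl
  have hle := X.card_labels_le_card_compl
  have h8 : #X.S < 8 := by
    by_contra! h8
    have h := card_le_of_triangle_free hp (no_triangle hp hG (by omega))
    -- `#X.labels ≤ 2 * r - 2` gives `#X.S ≤ d + 6`. Mantel then allows order at most 16 or 20,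
    -- against at least 18 or 21.
    have hs : #X.S = 8 ∨ (#X.S = 9 ∧ d = 3) := by omega
    rcases hs with hs | ⟨hs, rfl⟩
    · rw [hs] at h
      norm_num at h
      omega
    · rw [hs] at h
      norm_num at h
      omega
  have h7 : #X.S ≠ 7 := by
    intro h7
    exact card_S_ne_seven hp hG (by omega) (by omega) (by omega) h7
  refine ⟨by omega, ?_⟩
  rcases hd with rfl | rfl
  · subst hr
    exact absurd (by omega : #X.S = 6) (card_S_ne_six hp hG (by omega))
  · rfl

/-! ### Recognising the graphs on fifteen vertices -/

/-- The sum of two vectors of length three is injective once its entries are distinct. -/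
lemma sumElim_injective {α : Type*} {a b c a' b' c' : α} (h : [a, b, c, a', b', c'].Nodup) :
    Function.Injective (Sum.elim ![a, b, c] ![a', b', c'] : Fin 3 ⊕ Fin 3 → α) := by
  simp only [List.nodup_cons, List.mem_cons, not_or, List.not_mem_nil, not_false_eq_true,
    List.nodup_nil, and_true] at h
  rintro (i | i) (j | j) hij <;> fin_cases i <;> fin_cases j <;> simp_all

section Fifteen

variable {p : V → Finset V}
  (hp : ∀ u, #(p u) = 2 ∧ p u ⊆ X.missing u ∧ ∀ u', p u ⊆ X.missing u' → u' = u)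
  (h6 : #X.S = 6) (hk : 9 ≤ #X.labels)

include hp h6 hk

/-- The six-set has only 15 pairs, while `6 + 9` vertices need distinct ones; hence every fiber is a
singleton. -/
lemma card_eq_fifteen : Fintype.card V = 15 ∧ #X.labels = #X.Sᶜ := by
  have h1 := card_le_card (image_pairs_subset (U := univ) fun u _ => hp u)
  rw [card_image_of_injective _ (pairs_injective hp), card_univ, card_powersetCard, h6] at h1
  have h2 := X.card_labels_le_card_compl
  have h3 := X.card_add_card_compl
  have : Nat.choose 6 2 = 15 := by decide
  omega

lemma exists_pairs_eq {a b : V} (ha : a ∈ X.S) (hb : b ∈ X.S) (hab : a ≠ b) :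
    ∃ u, p u = {a, b} := by
  have h1 : univ.image p = powersetCard 2 X.S := by
    refine eq_of_subset_of_card_le (image_pairs_subset fun u _ => hp u) ?_
    rw [card_image_of_injective _ (pairs_injective hp), card_univ, card_powersetCard, h6,
      (card_eq_fifteen hp h6 hk).1]
    decide
  have h2 : ({a, b} : Finset V) ∈ univ.image p := by
    rw [h1, mem_powersetCard]
    refine ⟨?_, card_pair hab⟩
    simp [insert_subset_iff, ha, hb]
  obtain ⟨u, -, hu⟩ := mem_image.1 h2
  exact ⟨u, hu⟩

/-- Every pair in `S` is critical for some vertex, so each pair inside `X.missing u` must belong to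
`u`. -/
lemma pairs_eq_missing (u : V) : p u = X.missing u := by
  refine (hp u).2.1.antisymm fun x hx => ?_
  by_contra hxp
  obtain ⟨y, hy⟩ := card_pos.1 (by rw [(hp u).1]; omega : 0 < #(p u))
  have hym := (hp u).2.1 hy
  obtain ⟨w, hw⟩ := exists_pairs_eq hp h6 hk (missing_subset u hx) (missing_subset u hym)
    (by rintro rfl; exact hxp hy)
  have hwu : u = w := (hp w).2.2 u (by
    rw [hw]
    simp only [insert_subset_iff, singleton_subset_iff]
    exact ⟨hx, hym⟩)
  subst hwu
  exact hxp (by simp [hw])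

lemma label_injOn_compl {u v : V} (hu : u ∉ X.S) (hv : v ∉ X.S) (h : X.label u = X.label v) :
    u = v := by
  have h1 : Set.InjOn X.label (X.Sᶜ : Finset V) :=
    card_image_iff.1 (card_eq_fifteen hp h6 hk).2
  exact h1 (by simpa using hu) (by simpa using hv) h

/-- `N` lists non-adjacency in `H`. By `hcross` no vertex of `S` owns a cross pair, so the nine
cross pairs belong to the nine vertices outside `S` and determine their neighbours. -/
lemma nonempty_iso_exceptional15_of_embedding {H : SimpleGraph (Fin 3 ⊕ Fin 3)}
    {N : Fin 3 ⊕ Fin 3 → Finset (Fin 3 ⊕ Fin 3)} (hN2 : ∀ t, #(N t) = 2)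
    (hNH : ∀ s t, s ∈ N t ↔ s ≠ t ∧ ¬H.Adj s t)
    (hcross : ∀ s i j, Sum.inl i ∈ N s → Sum.inr j ∉ N s)
    {e : Fin 3 ⊕ Fin 3 → V} (he : Function.Injective e) (heS : ∀ s, e s ∈ X.S)
    (hNe : ∀ t, ∀ s ∈ N t, e s ∈ X.missing (e t)) : Nonempty (G ≃g exceptional15 H) := by
  have hmiss : ∀ t, X.missing (e t) = (N t).image e := by
    intro t
    symm
    refine eq_of_subset_of_card_le ?_ ?_
    · intro x hx
      obtain ⟨s, hs, rfl⟩ := mem_image.1 hx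
      exact hNe t s hs
    · rw [card_image_of_injective _ he, hN2, ← pairs_eq_missing hp h6 hk, (hp _).1]
  have hadj : ∀ s t, G.Adj (e s) (e t) ↔ H.Adj s t := by
    intro s t
    have h1 : e s ∈ X.missing (e t) ↔ s ∈ N t := by
      rw [hmiss, mem_image]
      exact ⟨fun ⟨s', hs', h⟩ => he h ▸ hs', fun h => ⟨s, h, rfl⟩⟩
    rw [hNH, mem_missing, he.ne_iff] at h1
    by_cases hst : s = t
    · subst hst
      simp
    · have := heS s
      tauto
  have hSe : ∀ v ∈ X.S, ∃ s, e s = v := by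
    have h1 : univ.image e = X.S := by
      refine eq_of_subset_of_card_le ?_ ?_
      · intro x hx
        obtain ⟨s, -, rfl⟩ := mem_image.1 hx
        exact heS s
      · rw [card_image_of_injective _ he, h6]
        simp
    intro v hv
    rw [← h1] at hv
    obtain ⟨s, -, hs⟩ := mem_image.1 hv
    exact ⟨s, hs⟩
  have hx : ∀ q : Fin 3 × Fin 3, ∃ u, p u = {e (.inl q.1), e (.inr q.2)} := fun q =>
    exists_pairs_eq hp h6 hk (heS _) (heS _) (he.ne (by simp))
  choose x hx using hx
  have hxm : ∀ q, X.missing (x q) = {e (.inl q.1), e (.inr q.2)} := fun q => by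
    rw [← pairs_eq_missing hp h6 hk, hx]
  have hxS : ∀ q, x q ∉ X.S := by
    intro q hq
    obtain ⟨s, hs⟩ := hSe _ hq
    have h1 := hxm q
    rw [← hs, hmiss] at h1
    have h2 : e (.inl q.1) ∈ (N s).image e := by simp [h1]
    have h3 : e (.inr q.2) ∈ (N s).image e := by simp [h1]
    rw [he.mem_finset_image] at h2 h3
    exact hcross s _ _ h2 h3
  let φ : (Fin 3 ⊕ Fin 3) ⊕ Fin 3 × Fin 3 → V := Sum.elim e x
  have hφ : Function.Injective φ := by
    refine Function.Injective.sumElim he ?_ ?_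
    · intro q q' h
      have h1 := hxm q
      rw [h, hxm q'] at h1
      have h2 : e (.inl q'.1) ∈ ({e (.inl q.1), e (.inr q.2)} : Finset V) := by simp [← h1]
      have h3 : e (.inr q'.2) ∈ ({e (.inl q.1), e (.inr q.2)} : Finset V) := by simp [← h1]
      simp only [mem_insert, mem_singleton, he.eq_iff, Sum.inl.injEq, Sum.inr.injEq, reduceCtorEq,
        or_false, false_or] at h2 h3
      exact Prod.ext h2.symm h3.symm
    · intro s q h
      exact hxS q (h ▸ heS s)
  have hbij : Function.Bijective φ := by
    rw [Fintype.bijective_iff_injective_and_card]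
    exact ⟨hφ, by simp [(card_eq_fifteen hp h6 hk).1]⟩
  have hex : ∀ s q, G.Adj (e s) (x q) ↔ s ≠ .inl q.1 ∧ s ≠ .inr q.2 := by
    intro s q
    have h1 : e s ∈ X.missing (x q) ↔ s = .inl q.1 ∨ s = .inr q.2 := by
      rw [hxm, mem_insert, mem_singleton, he.eq_iff, he.eq_iff]
    rw [mem_missing] at h1
    have h2 := heS s
    have h3 : e s ≠ x q := fun h => hxS q (h ▸ h2)
    tauto
  refine ⟨SimpleGraph.Iso.symm ⟨Equiv.ofBijective φ hbij, ?_⟩⟩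
  rintro (s | q) (t | q')
  · exact hadj s t
  · exact hex s q'
  · change G.Adj (x q) (e t) ↔ _
    rw [G.adj_comm]
    exact hex t q
  · change G.Adj (x q) (x q') ↔ False
    refine iff_false_intro fun h => ?_
    have := label_injOn_compl hp h6 hk (hxS q) (hxS q') (X.label_eq (hxS q) (hxS q') h)
    rw [this] at h
    exact G.irrefl h

lemma nonempty_iso_exceptional15 :
    Nonempty (G ≃g exceptional15 (completeBipartiteGraph (Fin 3) (Fin 3))) ∨
      Nonempty (G ≃g exceptional15 prism) := by
  have hm2 : ∀ v, #(X.missing v) = 2 := fun v => by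
    rw [← pairs_eq_missing hp h6 hk, (hp v).1]
  have hminj : ∀ u v, X.missing u = X.missing v → u = v := fun u v h =>
    pairs_injective hp (by rw [pairs_eq_missing hp h6 hk, pairs_eq_missing hp h6 hk, h])
  have hsymm : ∀ a b, b ∈ X.S → a ∈ X.missing b → b ∈ X.missing a := fun a b hb h =>
    mem_missing_comm hb h
  obtain ⟨v, hv⟩ := card_pos.1 (by omega : 0 < #X.S)
  obtain ⟨x, y, hxy, hvm⟩ := card_eq_two.1 (hm2 v)
  have hxv : x ∈ X.missing v := by simp [hvm]
  have hyv : y ∈ X.missing v := by simp [hvm]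
  have hx : x ∈ X.S := missing_subset v hxv
  have hy : y ∈ X.S := missing_subset v hyv
  have hvx := hsymm x v hv hxv
  have hvy := hsymm y v hv hyv
  have hnvx : x ≠ v := (mem_missing.1 hxv).2.1
  have hnvy : y ≠ v := (mem_missing.1 hyv).2.1
  by_cases hxym : x ∈ X.missing y
  -- Non-adjacency contains the triangle `v, x, y`; by 2-regularity the other three vertices form a
  -- second one.
  · left
    have hyx := hsymm x y hy hxym
    have hpair : ∀ {a b c : V}, a ≠ b → a ∈ X.missing c → b ∈ X.missing c →
        X.missing c = {a, b} := by
      intro a b c hab ha hb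
      symm
      refine eq_of_subset_of_card_le ?_ (by rw [hm2, card_pair hab])
      simp [insert_subset_iff, ha, hb]
    have hxm : X.missing x = {v, y} := hpair hnvy.symm hvx hyx
    have hym : X.missing y = {v, x} := hpair hnvx.symm hvy hxym
    have hc3 : #(X.S \ {v, x, y}) = 3 := by
      have h1 : ({v, x, y} : Finset V) ⊆ X.S := by simp [insert_subset_iff, hv, hx, hy]
      have h2 := card_sdiff_add_card_eq_card h1
      rw [card_eq_three.2 ⟨v, x, y, hnvx.symm, hnvy.symm, hxy, rfl⟩] at h2
      omega
    obtain ⟨a, b, c, hab, hac, hbc, hT⟩ := card_eq_three.1 hc3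
    have hTmem : ∀ t, t ∈ ({a, b, c} : Finset V) ↔ t ∈ X.S ∧ t ≠ v ∧ t ≠ x ∧ t ≠ y := by
      intro t
      rw [← hT]
      simp
    have ha := (hTmem a).1 (by simp)
    have hb := (hTmem b).1 (by simp)
    have hc := (hTmem c).1 (by simp)
    have hsub : ∀ t ∈ ({a, b, c} : Finset V), X.missing t ⊆ ({a, b, c} : Finset V).erase t := by
      intro t ht s hs
      have ht' := (hTmem t).1 ht
      have hst := hsymm s t ht'.1 hs
      refine mem_erase.2 ⟨(mem_missing.1 hs).2.1, (hTmem s).2 ⟨missing_subset t hs, ?_, ?_, ?_⟩⟩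
      · rintro rfl
        rw [hvm] at hst
        simp [ht'.2.2.1, ht'.2.2.2] at hst
      · rintro rfl
        rw [hxm] at hst
        simp [ht'.2.1, ht'.2.2.2] at hst
      · rintro rfl
        rw [hym] at hst
        simp [ht'.2.1, ht'.2.2.1] at hst
    have hTm : ∀ t ∈ ({a, b, c} : Finset V), ∀ s ∈ ({a, b, c} : Finset V), s ≠ t →
        s ∈ X.missing t := by
      intro t ht s hs hst
      rw [eq_of_subset_of_card_le (hsub t ht) (by
        rw [hm2, card_erase_of_mem ht, card_eq_three.2 ⟨a, b, c, hab, hac, hbc, rfl⟩])]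
      exact mem_erase.2 ⟨hst, hs⟩
    have hmab := hTm a (by simp) b (by simp) hab.symm
    have hmac := hTm a (by simp) c (by simp) hac.symm
    have hmbc := hTm b (by simp) c (by simp) hbc.symm
    have hmba := hsymm _ _ ha.1 hmab
    have hmca := hsymm _ _ ha.1 hmac
    have hmcb := hsymm _ _ hb.1 hmbc
    refine nonempty_iso_exceptional15_of_embedding hp h6 hk
      (N := Sum.elim (fun i => {.inl (i + 1), .inl (i + 2)}) fun i => {.inr (i + 1), .inr (i + 2)})
      (e := Sum.elim ![v, x, y] ![a, b, c]) ?_ ?_ ?_ (sumElim_injective ?_) ?_ ?_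
    · rintro (i | i) <;> exact card_pair (by simp)
    · rintro (i | i) (j | j) <;> simp <;> revert i j <;> decide
    · rintro (i | i) <;> simp
    · simp [hnvx.symm, hnvy.symm, hxy, hab, hac, hbc, ha.2.1.symm, hb.2.1.symm, hc.2.1.symm,
        ha.2.2.1.symm, hb.2.2.1.symm, hc.2.2.1.symm, ha.2.2.2.symm, hb.2.2.2.symm, hc.2.2.2.symm]
    · rintro (i | i) <;> fin_cases i <;> simp [hv, hx, hy, ha.1, hb.1, hc.1]
    · rintro (i | i) <;> fin_cases i <;>
        simp [hxv, hyv, hvx, hyx, hvy, hxym, hmab, hmac, hmba, hmbc, hmca, hmcb]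
  -- Non-adjacency turns out to be the hexagon `v, x, x', z, y', y`.
  · right
    obtain ⟨x', hx'v, hxm⟩ := exists_eq_pair_of_card_eq_two (hm2 x) hvx
    obtain ⟨y', hy'v, hym⟩ := exists_eq_pair_of_card_eq_two (hm2 y) hvy
    have hx'x : x' ∈ X.missing x := by simp [hxm]
    have hy'y : y' ∈ X.missing y := by simp [hym]
    have hx' : x' ∈ X.S := missing_subset x hx'x
    have hy' : y' ∈ X.S := missing_subset y hy'y
    have hxx' := hsymm x' x hx hx'x
    have hyy' := hsymm y' y hy hy'y
    have hyxm : y ∉ X.missing x := fun h => hxym (hsymm _ _ hx h)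
    have h1 : x' ≠ x := (mem_missing.1 hx'x).2.1
    have h2 : y' ≠ y := (mem_missing.1 hy'y).2.1
    have h3 : x' ≠ y := by
      rintro rfl
      exact hyxm hx'x
    have h4 : y' ≠ x := by
      rintro rfl
      exact hxym hy'y
    have h5 : x' ≠ y' := by
      rintro rfl
      refine hx'v (hminj _ _ ?_)
      rw [hvm]
      symm
      refine eq_of_subset_of_card_le ?_ (by rw [hm2, card_pair hxy])
      simp [insert_subset_iff, hxx', hyy']
    obtain ⟨z, hz, hzn⟩ : ∃ z ∈ X.S, z ∉ ({v, x, y, x', y'} : Finset V) := by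
      refine exists_mem_notMem_of_card_lt_card (lt_of_le_of_lt card_le_five ?_)
      omega
    simp only [mem_insert, mem_singleton, not_or] at hzn
    obtain ⟨hzv, hzx, hzy, hzx', hzy'⟩ := hzn
    have hS : ∀ t ∈ X.S, t = v ∨ t = x ∨ t = y ∨ t = x' ∨ t = y' ∨ t = z := by
      have hsub : ({v, x, y, x', y', z} : Finset V) ⊆ X.S := by
        simp [insert_subset_iff, hv, hx, hy, hx', hy', hz]
      have hcard : #({v, x, y, x', y', z} : Finset V) = 6 := by
        rw [card_insert_of_notMem, card_insert_of_notMem, card_insert_of_notMem,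
          card_insert_of_notMem, card_pair] <;>
        simp [hnvx.symm, hnvy.symm, hx'v.symm, hy'v.symm, Ne.symm hzv, hxy, h1.symm, h4.symm,
          Ne.symm hzx, h3.symm, h2.symm, Ne.symm hzy, h5, Ne.symm hzx', Ne.symm hzy']
      have h := eq_of_subset_of_card_le hsub (by rw [hcard, h6])
      intro t ht
      rw [← h] at ht
      simpa using ht
    obtain ⟨t, htx, hx'm⟩ := exists_eq_pair_of_card_eq_two (hm2 x') hxx'
    obtain ⟨t', hty, hy'm⟩ := exists_eq_pair_of_card_eq_two (hm2 y') hyy'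
    have htm : t ∈ X.missing x' := by simp [hx'm]
    have htm' : t' ∈ X.missing y' := by simp [hy'm]
    have htt := hsymm t x' hx' htm
    have htt' := hsymm t' y' hy' htm'
    have htz : t = z ∨ t = y' := by
      have := (mem_missing.1 htm).2.1
      rcases hS t (missing_subset _ htm) with rfl | rfl | rfl | rfl | rfl | rfl
      · rw [hvm] at htt
        simp [h1, h3] at htt
      · contradiction
      · rw [hym] at htt
        simp [hx'v, h5] at htt
      · contradiction
      · exact Or.inr rfl
      · exact Or.inl rfl
    have htz' : t' = z ∨ t' = x' := by
      have := (mem_missing.1 htm').2.1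
      rcases hS t' (missing_subset _ htm') with rfl | rfl | rfl | rfl | rfl | rfl
      · rw [hvm] at htt'
        simp [h2, h4] at htt'
      · rw [hxm] at htt'
        simp [hy'v, h5.symm] at htt'
      · contradiction
      · exact Or.inr rfl
      · contradiction
      · exact Or.inl rfl
    -- Otherwise `x'` and `y'` close a 5-cycle and `z` has no possible non-neighbour left in `S`.
    have hz2 : t = z ∧ t' = z := by
      by_contra hcon
      have hboth : t = y' ∧ t' = x' := by
        rcases htz with rfl | rfl
        · rcases htz' with rfl | rfl
          · exact absurd ⟨rfl, rfl⟩ hcon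
          · rw [hx'm] at htt'
            simp [h4, Ne.symm hzy'] at htt'
        · rcases htz' with rfl | rfl
          · rw [hy'm] at htt
            simp [h3, Ne.symm hzx'] at htt
          · exact ⟨rfl, rfl⟩
      obtain ⟨rfl, rfl⟩ := hboth
      obtain ⟨w, hw⟩ := card_pos.1 (by rw [hm2]; omega : 0 < #(X.missing z))
      have hwz := hsymm w z hz hw
      rcases hS w (missing_subset _ hw) with rfl | rfl | rfl | rfl | rfl | rfl
      · rw [hvm] at hwz
        simp [hzx, hzy] at hwz
      · rw [hxm] at hwz
        simp [hzv, hzx'] at hwz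
      · rw [hym] at hwz
        simp [hzv, hzy'] at hwz
      · rw [hx'm] at hwz
        simp [hzx, hzy'] at hwz
      · rw [hy'm] at hwz
        simp [hzy, hzx'] at hwz
      · exact notMem_missing_self _ hw
    rw [hz2.1] at htm htt
    rw [hz2.2] at htm' htt'
    -- The bipartition classes of the hexagon are the prism's triangles; opposite vertices of the
    -- hexagon get equal indices.
    refine nonempty_iso_exceptional15_of_embedding hp h6 hk
      (N := Sum.elim (fun i => {.inr (i + 1), .inr (i + 2)}) fun i => {.inl (i + 1), .inl (i + 2)})
      (e := Sum.elim ![v, x', y'] ![z, y, x]) ?_ ?_ ?_ (sumElim_injective ?_) ?_ ?_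
    · rintro (i | i) <;> exact card_pair (by simp)
    · rintro (i | i) (j | j) <;> simp [prism] <;> revert i j <;> decide
    · rintro (i | i) <;> simp
    · simp [hx'v.symm, hy'v.symm, Ne.symm hzv, hnvy.symm, hnvx.symm, h5, Ne.symm hzx', h3, h1,
        Ne.symm hzy', h2, h4, hzy, hzx, hxy.symm]
    · rintro (i | i) <;> fin_cases i <;> simp [hv, hx', hy', hx, hy, hz]
    · rintro (i | i) <;> fin_cases i <;>
        simp [hxv, hyv, hxx', hyy', hvx, hvy, hx'x, hy'y, htm, htt, htm', htt']

end Fifteen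

/-! ### The two cases of the theorem -/

lemma false_of_even (hD : ∀ v, ∃ a b, CriticalPair G v a b) (hG : IsStarFree 6 G)
    (hV : Even (Fintype.card V)) (h12 : Fintype.card V ≠ 12) (hX : #X.S + 2 ≤ #X.oddLabels) :
    False := by
  have hle := X.card_oddLabels_le
  have hne := S_nonempty_of_even (X := X) hD hV (by omega)
  have h3 := three_le_card_S (X := X) hD hne (by omega)
  rcases Nat.lt_or_ge #X.S 6 with h6 | h6
  · interval_cases hs : #X.S
    · rcases Nat.lt_or_ge 5 #X.labels with hk | hk
      -- The nine-vertex graph has odd order, so it cannot occur here.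
      · obtain ⟨f⟩ := nonempty_iso_exceptional9 hD hs hk
        have := Fintype.card_congr f.toEquiv
        simp at this
        rw [this] at hV
        exact absurd hV (by decide)
      · obtain ⟨i, hi, heven⟩ := exists_even_fiber_of_card_three (X := X) hD hs (by omega)
        have : X.oddLabels = X.labels := eq_of_subset_of_card_le X.oddLabels_subset (by omega)
        rw [← this] at hi
        exact (Nat.not_even_iff_odd.2 (mem_filter.1 hi).2) heven
    · exact card_S_ne_four hD (by omega) (Or.inl hG) hs
    · exact card_S_ne_five hG hD le_rfl (by omega) h12 hs
  · have hin := inner_of_star_free (X := X) hG hD (by omega) (by omega)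
    have := card_S_le_six hG hin (Or.inl rfl) rfl h6 (by omega)
    omega

/-- With injective labels and no cut vertices the graph is edgeless, so each of its several vertices
is an odd component. -/
lemma false_of_ncard_oddComponents (hD : ∀ v, ∃ a b, CriticalPair G v a b)
    (hcomp : G.oddComponents.ncard = 1) (hS : X.S = ∅) (hk : 3 ≤ #X.labels) : False := by
  obtain ⟨hinj, -⟩ := label_injective_of_empty hD hS hk
  have hbot : G = ⊥ := by
    ext u v
    simp only [SimpleGraph.bot_adj, iff_false]
    intro h
    exact h.ne (hinj (X.label_eq (by simp [hS]) (by simp [hS]) h))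
  subst hbot
  have hall : ∀ v, (⊥ : SimpleGraph V).connectedComponentMk v ∈
      (⊥ : SimpleGraph V).oddComponents := by
    intro v
    have : ((⊥ : SimpleGraph V).connectedComponentMk v).supp = {v} := by
      ext u
      simp
    simp [this]
  obtain ⟨C, hC⟩ := Set.ncard_eq_one.1 hcomp
  have h1 : 1 < #X.Sᶜ := by
    have := X.card_labels_le_card_compl
    omega
  obtain ⟨u, -, v, -, huv⟩ := one_lt_card.1 h1
  have hu := hall u
  have hv := hall v
  rw [hC, Set.mem_singleton_iff] at hu hv
  have := SimpleGraph.ConnectedComponent.exact (hu.trans hv.symm)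
  rw [SimpleGraph.reachable_bot] at this
  exact huv this

lemma nonempty_iso_of_odd (hD : ∀ v, ∃ a b, CriticalPair G v a b) (hG : IsStarFree 7 G)
    (hcomp : G.oddComponents.ncard = 1) (h13 : Fintype.card V ≠ 13)
    (hX : #X.S + 3 ≤ #X.oddLabels) :
    Nonempty (G ≃g exceptional9) ∨
      Nonempty (G ≃g exceptional15 (completeBipartiteGraph (Fin 3) (Fin 3))) ∨
      Nonempty (G ≃g exceptional15 prism) := by
  have hle := X.card_oddLabels_le
  have hne : X.S ≠ ∅ := fun hS =>
    false_of_ncard_oddComponents hD hcomp hS (by omega)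
  have h3 := three_le_card_S (X := X) hD hne (by omega)
  rcases Nat.lt_or_ge #X.S 6 with h6 | h6
  · interval_cases hs : #X.S
    · exact Or.inl (nonempty_iso_exceptional9 (X := X) hD hs (by omega))
    · exact absurd hs (card_S_ne_four hD (by omega) (Or.inr (by omega)))
    · exact absurd hs (card_S_ne_five hG hD (by omega) (by omega) h13)
  · have hin := inner_of_star_free (X := X) hG hD (by omega) (by omega)
    have hs := (card_S_le_six hG hin (Or.inr rfl) rfl h6 (by omega)).1
    obtain ⟨p, hp⟩ := exists_pairs (X := X) univ fun u _ => hin u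
    exact Or.inr (nonempty_iso_exceptional15 (fun u => hp u (mem_univ u)) hs (by omega))

end LabelledCut

end

end DomCrit

theorem theorem1p4 {V : Type*} [Fintype V] (G : SimpleGraph V)
    (hG : DomCrit.IsGammaVertexCritical 3 G) :
    (DomCrit.IsStarFree 6 G → Even (Fintype.card V) → Fintype.card V ≠ 12 →
      DomCrit.HasPerfectMatching G) ∧
    (DomCrit.IsStarFree 7 G → Odd (Fintype.card V) → G.oddComponents.ncard = 1 →
      Fintype.card V ≠ 13 →
      DomCrit.HasNearPerfectMatching G ∨
        Nonempty (G ≃g DomCrit.exceptional9) ∨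
        Nonempty (G ≃g DomCrit.exceptional15 (completeBipartiteGraph (Fin 3) (Fin 3))) ∨
        Nonempty (G ≃g DomCrit.exceptional15 DomCrit.prism)) := by
  have hD := DomCrit.exists_criticalPair hG
  refine ⟨fun h6 hV h12 => ?_, fun h7 hV hcomp h13 => ?_⟩
  · by_contra hM
    obtain ⟨X, hX⟩ := DomCrit.exists_labelledCut G hV hM
    exact DomCrit.LabelledCut.false_of_even hD h6 hV h12 hX
  · refine or_iff_not_imp_left.2 fun hM => ?_
    obtain ⟨X, hX⟩ := DomCrit.exists_labelledCut_of_odd G hV hM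
    exact DomCrit.LabelledCut.nonempty_iso_of_odd hD h7 hcomp h13 hX
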